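/- All manifolds and maps are smooth. An almost contact metric structure on a $(2m+1)$-dimensional manifold $\widetilde M$ consists of a $(1,1)$-tensor field $\phi$, a vector field $\xi$, a $1$-form $\eta$ and a Riemannian metric $\widetilde g$ with $\phi^2=-I+\eta\otimes\xi$, $\phi\xi=0$, $\eta\circ\phi=0$, $\eta(\xi)=1$ and $\widetilde g(\phi X,\phi Y)=\widetilde g(X,Y)-\eta(X)\eta(Y)$. It is trans-Sasakian of type $(\alpha,\beta)$, where $\alpha,\beta\in C^\infty(\widetilde M)$, if the Levi-Civita connection satisfies $$(\widetilde\nabla_X\phi)Y=\alpha\bigl(\widetilde g(X,Y)\xi-\eta(Y)X\bigr)+\beta\bigl(\widetilde g(\phi X,Y)\xi-\eta(Y)\phi X\bigr);$$ it is called $\alpha$-Sasakian, $\beta$-Kenmotsu, cosymplectic if its type is $(\alpha,0)$, $(0,\beta)$, $(0,0)$ respectively. Let $(N^\top,g_{N^\top})$, $(N^\bot,g_{N^\bot})$ be connected Riemannian manifolds, let $f_1:N^\top\to(0,\infty)$, $f_2:N^\bot\to(0,\infty)$ be smooth, and let $M=N^\top\times N^\bot$ carry the doubly warped product metric $g=f_2^2\,g_{N^\top}\oplus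 f_1^2\,g_{N^\bot}$. Let $\mathcal D$ be the distribution on $M$ tangent to the leaves $N^\top\times\{y\}$ and $\mathcal D^\bot$ its orthogonal complement. Suppose that $\iota:(M,g)\to\widetilde M$ is an isometric immersion that makes $M$ a contact CR-submanifold with distribution $\mathcal D$, that is: $\xi$ is tangent to $M$, $\phi\mathcal D\subset\mathcal D$, and $\phi\mathcal D^\bot$ is normal to $M$. Suppose that $\widetilde M$ is (1) $\alpha$-Sasakian, or (2) $\beta$-Kenmotsu, or (3) cosymplectic. Then $f_1$ and $f_2$ are not both non-constant, i.e. there is no proper (non-trivial) doubly warped product contact CR-submanifold in $\widetilde M$. More precisely, either $\xi\in\mathcal D$ at all points of $M$ or $\xi\in\mathcal D^\bot$ at all points of $M$, and: * If $\xi\in\mathcal D$, then $M=\widetilde N^\top\times{}_fN^\bot$, that is $g=c^2g_{N^\top}\oplus f^2g_{N^\bot}$, for some constant $c>0$ and some positive $f\in C^\infty(N^\top)$, where $\widetilde N^\top=(N^\top,c^2g_{N^\top})$. Moreover, in case (2), $\beta$ is along $M$ a smooth function on $N^\top$: $\beta(\iota(x,y))=b(x)$ for some $b\in C^\infty(N^\top)$.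 * If $\xi\in\mathcal D^\bot$: in case (1), either $M$ is a $\phi$-anti-invariant submanifold ($\phi$ maps $TM$ into the normal bundle) and $\dim\mathcal D=0$, or $\alpha$ vanishes identically along $M$ and $M=\widetilde N^\bot\times{}_fN^\top$ as below; in particular $M$ is $\phi$-anti-invariant if $\alpha$ has no zeros. In cases (2) and (3), $M=\widetilde N^\bot\times{}_fN^\top$, that is $g=f^2g_{N^\top}\oplus c^2g_{N^\bot}$, for some constant $c>0$ and some positive $f\in C^\infty(N^\bot)$, where $\widetilde N^\bot=(N^\bot,c^2g_{N^\bot})$. Moreover, in case (2), $\beta(\iota(x,y))=b(y)$ for some $b\in C^\infty(N^\bot)$. -/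

import Mathlib

open Bundle Manifold
open scoped ContDiff

noncomputable section

namespace TransSasakian

section Manifolds

variable {E : Type*} [NormedAddCommGroup E] [NormedSpace ℝ E]
  {H : Type*} [TopologicalSpace H]
  {E' : Type*} [NormedAddCommGroup E'] [NormedSpace ℝ E']
  {H' : Type*} [TopologicalSpace H']

/-- A smooth Riemannian metric on the manifold `M` (with model `I`). -/
abbrev RiemMetric (I : ModelWithCorners ℝ E H) (M : Type*) [TopologicalSpace M]
    [ChartedSpace H M] [IsManifold I ∞ M] :=
  ContMDiffRiemannianMetric I ∞ E (fun x : M ↦ TangentSpace I x)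

/-- `cov` is the Levi-Civita connection of the Riemannian metric `g`: it is compatible with `g`,
`v (g(X, Y)) = g(∇_v X, Y) + g(X, ∇_v Y)`, and has no torsion. Here `cov X x v` is `∇_v X` at `x`. -/
def IsLeviCivita [FiniteDimensional ℝ E] [CompleteSpace E] {I : ModelWithCorners ℝ E H}
    {M : Type*} [TopologicalSpace M] [ChartedSpace H M] [IsManifold I ∞ M]
    (g : RiemMetric I M) (cov : CovariantDerivative I E (fun x : M ↦ TangentSpace I x)) : Prop :=
  (∀ (x : M) (v : TangentSpace I x) (X Y : ∀ x : M, TangentSpace I x),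
    MDifferentiableAt I (I.prod 𝓘(ℝ, E))
      (fun y ↦ TotalSpace.mk' E (E := fun x : M ↦ TangentSpace I x) y (X y)) x →
    MDifferentiableAt I (I.prod 𝓘(ℝ, E))
      (fun y ↦ TotalSpace.mk' E (E := fun x : M ↦ TangentSpace I x) y (Y y)) x →
    mvfderiv I (fun y ↦ g.inner y (X y) (Y y)) x v =
      g.inner x (cov X x v) (Y x) + g.inner x (X x) (cov Y x v)) ∧
  cov.torsion = 0

/-- An almost contact metric structure `(φ, ξ, η, g)` on `M`. -/
structure AlmostContactMetric (I : ModelWithCorners ℝ E H) (M : Type*) [TopologicalSpace M]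
    [ChartedSpace H M] [IsManifold I ∞ M] where
  φ : ∀ x : M, TangentSpace I x →L[ℝ] TangentSpace I x
  ξ : ∀ x : M, TangentSpace I x
  η : ∀ x : M, TangentSpace I x →L[ℝ] ℝ
  g : RiemMetric I M
  contMDiff_φ : ContMDiff I (I.prod 𝓘(ℝ, E →L[ℝ] E)) ∞
    (fun x ↦ TotalSpace.mk' (E →L[ℝ] E)
      (E := fun x : M ↦ TangentSpace I x →L[ℝ] TangentSpace I x) x (φ x))
  contMDiff_ξ : ContMDiff I (I.prod 𝓘(ℝ, E)) ∞
    (fun x ↦ TotalSpace.mk' E (E := fun x : M ↦ TangentSpace I x) x (ξ x))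
  contMDiff_η : ContMDiff I (I.prod 𝓘(ℝ, E →L[ℝ] ℝ)) ∞
    (fun x ↦ TotalSpace.mk' (E →L[ℝ] ℝ)
      (E := fun x : M ↦ TangentSpace I x →L[ℝ] Bundle.Trivial M ℝ x) x (η x))
  φ_φ : ∀ x v, φ x (φ x v) = -v + η x v • ξ x
  φ_ξ : ∀ x, φ x (ξ x) = 0
  η_φ : ∀ x v, η x (φ x v) = 0
  η_ξ : ∀ x, η x (ξ x) = 1
  g_φ_φ : ∀ x v w, g.inner x (φ x v) (φ x w) = g.inner x v w - η x v * η x w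

/-- A trans-Sasakian structure of type `(α, β)`: `α`, `β` are smooth functions and
`(∇_X φ) Y = α (g(X, Y) ξ - η(Y) X) + β (g(φ X, Y) ξ - η(Y) φ X)`, where `∇` is the Levi-Civita
connection and `(∇_X φ) Y = ∇_X (φ Y) - φ (∇_X Y)`.
Here `cov Y x v` is `∇_v Y` at the point `x`. -/
def IsTransSasakian [FiniteDimensional ℝ E] [CompleteSpace E] {I : ModelWithCorners ℝ E H}
    {M : Type*} [TopologicalSpace M] [ChartedSpace H M] [IsManifold I ∞ M]
    (S : AlmostContactMetric I M) (α β : M → ℝ) : Prop :=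
  ContMDiff I 𝓘(ℝ, ℝ) ∞ α ∧ ContMDiff I 𝓘(ℝ, ℝ) ∞ β ∧
  ∃ cov : CovariantDerivative I E (fun x : M ↦ TangentSpace I x), IsLeviCivita S.g cov ∧
    ∀ (x : M) (v : TangentSpace I x) (Y : ∀ x : M, TangentSpace I x),
      MDifferentiableAt I (I.prod 𝓘(ℝ, E))
        (fun y ↦ TotalSpace.mk' E (E := fun x : M ↦ TangentSpace I x) y (Y y)) x →
      cov (fun y ↦ S.φ y (Y y)) x v - S.φ x (cov Y x v) =
        α x • (S.g.inner x v (Y x) • S.ξ x - S.η x (Y x) • v) +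
        β x • (S.g.inner x (S.φ x v) (Y x) • S.ξ x - S.η x (Y x) • S.φ x v)

/-- `α`-Sasakian: trans-Sasakian of type `(α, 0)`. -/
def IsAlphaSasakian [FiniteDimensional ℝ E] [CompleteSpace E] {I : ModelWithCorners ℝ E H}
    {M : Type*} [TopologicalSpace M] [ChartedSpace H M] [IsManifold I ∞ M]
    (S : AlmostContactMetric I M) (α : M → ℝ) : Prop :=
  IsTransSasakian S α (fun _ ↦ 0)

/-- `β`-Kenmotsu: trans-Sasakian of type `(0, β)`. -/
def IsBetaKenmotsu [FiniteDimensional ℝ E] [CompleteSpace E] {I : ModelWithCorners ℝ E H}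
    {M : Type*} [TopologicalSpace M] [ChartedSpace H M] [IsManifold I ∞ M]
    (S : AlmostContactMetric I M) (β : M → ℝ) : Prop :=
  IsTransSasakian S (fun _ ↦ 0) β

/-- Cosymplectic: trans-Sasakian of type `(0, 0)`. -/
def IsCosymplectic [FiniteDimensional ℝ E] [CompleteSpace E] {I : ModelWithCorners ℝ E H}
    {M : Type*} [TopologicalSpace M] [ChartedSpace H M] [IsManifold I ∞ M]
    (S : AlmostContactMetric I M) : Prop :=
  IsTransSasakian S (fun _ ↦ 0) (fun _ ↦ 0)

section Submanifolds

variable {I : ModelWithCorners ℝ E H} {M : Type*} [TopologicalSpace M] [ChartedSpace H M]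
  [IsManifold I ∞ M] {I' : ModelWithCorners ℝ E' H'} {M' : Type*} [TopologicalSpace M']
  [ChartedSpace H' M'] [IsManifold I' ∞ M']

/-- `ι : (M, g) → (M', g')` is an isometric immersion. -/
structure IsIsometricImmersion (g : RiemMetric I M) (g' : RiemMetric I' M') (ι : M → M') :
    Prop where
  contMDiff : ContMDiff I I' ∞ ι
  isometric : ∀ (z : M) (u v : TangentSpace I z),
    g'.inner (ι z) (mfderiv I I' ι z u) (mfderiv I I' ι z v) = g.inner z u v

/-- A smooth distribution on `M`: a family of subspaces of the tangent spaces, of constant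
dimension, spanned by smooth vector fields. -/
structure IsSmoothDistribution (D : ∀ z : M, Submodule ℝ (TangentSpace I z)) : Prop where
  finrank_eq : ∀ z z' : M, Module.finrank ℝ (D z) = Module.finrank ℝ (D z')
  exists_section : ∀ (z : M) (v : TangentSpace I z), v ∈ D z →
    ∃ X : ∀ z : M, TangentSpace I z,
      ContMDiff I (I.prod 𝓘(ℝ, E)) ∞
        (fun y ↦ TotalSpace.mk' E (E := fun x : M ↦ TangentSpace I x) y (X y)) ∧
      X z = v ∧ ∀ y, X y ∈ D y

/-- The orthogonal complement `D^⊥` in `TM` of the distribution `D`, with respect to `g`. -/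
def orthDistribution (g : RiemMetric I M) (D : ∀ z : M, Submodule ℝ (TangentSpace I z)) (z : M) :
    Submodule ℝ (TangentSpace I z) where
  carrier := {v | ∀ u ∈ D z, g.inner z u v = 0}
  add_mem' := fun ha hb u hu ↦ by rw [map_add, ha u hu, hb u hu, add_zero]
  zero_mem' := fun u _ ↦ by rw [map_zero]
  smul_mem' := fun c v hv u hu ↦ by rw [map_smul, hv u hu, smul_zero]

/-- `ι : (M, g) → M'` makes `M` a contact CR-submanifold (tangent to `ξ`) of the almost contact
metric manifold `(M', S)`, with `φ`-invariant distribution `D` and `φ`-anti-invariant orthogonal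
complement `D^⊥`. -/
structure IsContactCRSubmanifold (S : AlmostContactMetric I' M') (g : RiemMetric I M)
    (ι : M → M') (D : ∀ z : M, Submodule ℝ (TangentSpace I z)) : Prop where
  isometricImmersion : IsIsometricImmersion g S.g ι
  smoothDistribution : IsSmoothDistribution D
  ξ_tangent : ∀ z, ∃ v : TangentSpace I z, mfderiv I I' ι z v = S.ξ (ι z)
  invariant : ∀ (z : M), ∀ v ∈ D z, ∃ w ∈ D z, mfderiv I I' ι z w = S.φ (ι z) (mfderiv I I' ι z v)
  antiInvariant : ∀ (z : M), ∀ v ∈ orthDistribution g D z, ∀ w : TangentSpace I z,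
    S.g.inner (ι z) (S.φ (ι z) (mfderiv I I' ι z v)) (mfderiv I I' ι z w) = 0

/-- `ξ ∈ D` along `M`. -/
def XiIn (S : AlmostContactMetric I' M') (ι : M → M')
    (D : ∀ z : M, Submodule ℝ (TangentSpace I z)) : Prop :=
  ∀ z, ∃ v ∈ D z, mfderiv I I' ι z v = S.ξ (ι z)

/-- `M` is a `φ`-anti-invariant submanifold: `φ` maps every tangent vector of `M` to a normal
vector. -/
def IsAntiInvariant (S : AlmostContactMetric I' M') (ι : M → M') : Prop :=
  ∀ (z : M) (v w : TangentSpace I z),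
    S.g.inner (ι z) (S.φ (ι z) (mfderiv I I' ι z v)) (mfderiv I I' ι z w) = 0

set_option synthInstance.maxHeartbeats 400000 in
/-- The homothetic metric `c² g`. -/
def homothetic [FiniteDimensional ℝ E] (c : ℝ) (hc : 0 < c) (g : RiemMetric I M) :
    RiemMetric I M where
  inner x := (c ^ 2) • g.inner x
  symm x v w := by simp [g.symm x v w]
  pos x v hv := by
    have := g.pos x v hv
    simp only [smul_apply, smul_eq_mul]
    positivity
  isVonNBounded x := by
    have h := (g.isVonNBounded x).image ((c⁻¹) • ContinuousLinearMap.id ℝ (TangentSpace I x))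
    refine h.subset ?_
    intro v hv
    refine ⟨c • v, ?_, ?_⟩
    · simp only [Set.mem_ofPred_eq, smul_apply, smul_eq_mul, map_smul] at hv ⊢
      nlinarith
    · simp [smul_smul, hc.ne']
  contMDiff := g.contMDiff.const_smul_section

end Submanifolds

section Products

variable {IB : ModelWithCorners ℝ E H} {B : Type*} [TopologicalSpace B] [ChartedSpace H B]
  [IsManifold IB ∞ B] {IF : ModelWithCorners ℝ E' H'} {F : Type*} [TopologicalSpace F]
  [ChartedSpace H' F] [IsManifold IF ∞ F]

/-- The metric `g` on `B × F` is the doubly warped product metric `f² g_B ⊕ b² g_F`, where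
`f : F → (0, ∞)` and `b : B → (0, ∞)` are smooth. -/
structure IsDoublyWarped (g : RiemMetric (IB.prod IF) (B × F)) (f : F → ℝ) (gB : RiemMetric IB B)
    (b : B → ℝ) (gF : RiemMetric IF F) : Prop where
  contMDiff_f : ContMDiff IF 𝓘(ℝ, ℝ) ∞ f
  f_pos : ∀ y, 0 < f y
  contMDiff_b : ContMDiff IB 𝓘(ℝ, ℝ) ∞ b
  b_pos : ∀ x, 0 < b x
  metric_eq : ∀ (z : B × F) (u v : TangentSpace (IB.prod IF) z),
    g.inner z u v =
      f z.2 ^ 2 * gB.inner z.1 (mfderiv (IB.prod IF) IB Prod.fst z u)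
        (mfderiv (IB.prod IF) IB Prod.fst z v) +
      b z.1 ^ 2 * gF.inner z.2 (mfderiv (IB.prod IF) IF Prod.snd z u)
        (mfderiv (IB.prod IF) IF Prod.snd z v)

/-- `(B × F, g)` is the (single) warped product with base `(B, gB)`, fibre `(F, gF)` and warping
function `b` on `B`: `g = g_B ⊕ b² g_F`. -/
def IsWarpedOverFst (g : RiemMetric (IB.prod IF) (B × F)) (gB : RiemMetric IB B)
    (b : B → ℝ) (gF : RiemMetric IF F) : Prop :=
  IsDoublyWarped g (fun _ ↦ 1) gB b gF

/-- `(B × F, g)` is the (single) warped product with base `(F, gF)`, fibre `(B, gB)` and warping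
function `f` on `F`: `g = f² g_B ⊕ g_F`. -/
def IsWarpedOverSnd (g : RiemMetric (IB.prod IF) (B × F)) (f : F → ℝ) (gB : RiemMetric IB B)
    (gF : RiemMetric IF F) : Prop :=
  IsDoublyWarped g f gB (fun _ ↦ 1) gF

variable (IB IF B F) in
/-- The distribution on `B × F` tangent to the leaves `B × {y}`. -/
def leafDistribution (z : B × F) : Submodule ℝ (TangentSpace (IB.prod IF) z) :=
  LinearMap.range
    (mfderiv IB (IB.prod IF) (fun x : B ↦ (x, z.2)) z.1 :
      TangentSpace IB z.1 →L[ℝ] TangentSpace (IB.prod IF) z).toLinearMap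

/-- `ι` makes `(N₁ × N₂, g)`, `g = f₂² g₁ ⊕ f₁² g₂`, a doubly warped product contact
CR-submanifold of `(M', S)`, where `N₁ = N^⊤` is `φ`-invariant and `N₂ = N^⊥` is
`φ`-anti-invariant. -/
structure IsDoublyWarpedContactCR {E'' : Type*} [NormedAddCommGroup E''] [NormedSpace ℝ E'']
    {H'' : Type*} [TopologicalSpace H''] {I' : ModelWithCorners ℝ E'' H''} {M' : Type*}
    [TopologicalSpace M'] [ChartedSpace H'' M'] [IsManifold I' ∞ M']
    (S : AlmostContactMetric I' M') (g : RiemMetric (IB.prod IF) (B × F)) (ι : B × F → M')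
    (f₂ : F → ℝ) (g₁ : RiemMetric IB B) (f₁ : B → ℝ) (g₂ : RiemMetric IF F) : Prop where
  doublyWarped : IsDoublyWarped g f₂ g₁ f₁ g₂
  contactCR : IsContactCRSubmanifold S g ι (leafDistribution IB B IF F)

end Products

/-- The function `f` is constant. -/
def IsConst {X : Type*} (f : X → ℝ) : Prop := ∃ c, ∀ x, f x = c

end Manifolds

end TransSasakian

end

/-! On a trans-Sasakian manifold `∇_v ξ = -α φ v + β (v - η(v) ξ)` (`IsTransSasakian.exists_cov_ξ`).
Its skew part gives `dη(X, Y) = -2 α g(φ X, Y)`, its symmetric part gives the derivative of lengths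
along `ξ`. Only these two consequences are used. Both are pulled back along maps `u` from a vector
space into the ambient manifold, with `u` the immersion composed with inverse charts of the two
factors, so neither the connection of `M` nor its second fundamental form appears.

Dichotomy (`IsWarpedMap.ξ_left_or_right`): if `η(X) ≠ 0` for some `X` in `D`, then `φ² X = -X + η(X)
ξ` lies in `D`, hence so does `ξ`. Otherwise `ξ` is orthogonal to `D`. Both alternatives are open
conditions, and `M` is connected.

Constancy (`IsLocalWarped.warping_eq`): let `ξ` be tangent to one factor, with coordinate vector `X`
there, let `Y` be tangent to that factor and `Z` to the other, all with constant coordinates. Since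
`η(Z) = 0` and `φ Z ⊥ Y`, the formula for `dη` gives `Z(η(Y)) = 0`. As `η(Y) = F₂² G₁(X, Y)`, the
vector `F₂² X` is independent of the second variable; its `G₁`-square is `F₂²`, because `η(ξ) = 1`.
So `F₂` is constant. The argument is symmetric in the factors (`IsWarpedMap.swap`) and so covers
both positions of `ξ`.

The function `β` (`IsLocalWarped.β_eq`): now `X` itself is independent of the second variable, and
differentiating `|Z|² = F₁² G₂(Z, Z)` along `ξ` gives `X(F₁²) = 2 β F₁²`, which determines `β` from
data on the factor of `ξ`.

The function `α` (`IsWarpedMap.α_eq_zero`): if `ξ ⊥ D`, then `η` vanishes on the leaves of `D`, so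
`0 = dη(X, φ X) = -2 α |X|²` for `X` in `D`. Hence `α = 0` unless `D = 0`. -/

noncomputable section

namespace TransSasakian

open scoped Topology

/-! ### Coordinate fields, and metrics, vector fields and maps in charts -/

section ConstantFields

variable {E : Type*} [NormedAddCommGroup E] [NormedSpace ℝ E]
  {H : Type*} [TopologicalSpace H] {I : ModelWithCorners ℝ E H}
  {M : Type*} [TopologicalSpace M] [ChartedSpace H M] [IsManifold I ∞ M]

/-- The vector field which is constant, equal to `w`, in the chart at `x₀`. -/
def constField (I : ModelWithCorners ℝ E H) [IsManifold I ∞ M] (x₀ : M) (w : E) (x : M) :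
    TangentSpace I x :=
  (trivializationAt E (fun x : M ↦ TangentSpace I x) x₀).symmL ℝ x w

lemma contMDiffAt_constField (x₀ : M) (w : E) :
    ContMDiffAt I (I.prod 𝓘(ℝ, E)) ∞
      (fun y ↦ TotalSpace.mk' E (E := fun x : M ↦ TangentSpace I x) y (constField I x₀ w y)) x₀ := by
  rw [contMDiffAt_section]
  refine (contMDiffAt_const (c := w)).congr_of_eventuallyEq ?_
  filter_upwards [(chartAt H x₀).open_source.mem_nhds (mem_chart_source H x₀)] with x hx
  have hx' : x ∈ (trivializationAt E (fun x : M ↦ TangentSpace I x) x₀).baseSet := by simpa using hx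
  rw [← Trivialization.continuousLinearMapAt_apply_of_mem (R := ℝ) _ hx']
  exact Trivialization.continuousLinearMapAt_symmL _ hx' w

lemma mdifferentiableAt_constField (x₀ : M) (w : E) :
    MDifferentiableAt I (I.prod 𝓘(ℝ, E))
      (fun y ↦ TotalSpace.mk' E (E := fun x : M ↦ TangentSpace I x) y (constField I x₀ w y)) x₀ :=
  (contMDiffAt_constField x₀ w).mdifferentiableAt (by simp)

lemma eventually_mem_chartAt_source (x₀ : M) : ∀ᶠ x in 𝓝 x₀, x ∈ (chartAt H x₀).source :=
  (chartAt H x₀).open_source.mem_nhds (mem_chart_source H x₀)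

/-- The components of a tangent vector in the chart at `x₀`. -/
def chartDeriv (I : ModelWithCorners ℝ E H) [IsManifold I ∞ M] (x₀ x : M) :
    TangentSpace I x →L[ℝ] E :=
  (trivializationAt E (fun x : M ↦ TangentSpace I x) x₀).continuousLinearMapAt ℝ x

lemma chartDeriv_eq_mfderiv {x₀ x : M} (hx : x ∈ (chartAt H x₀).source) :
    chartDeriv I x₀ x = mfderiv I 𝓘(ℝ, E) (extChartAt I x₀) x :=
  TangentBundle.continuousLinearMapAt_trivializationAt hx

@[simp]
lemma chartDeriv_constField {x₀ x : M} (hx : x ∈ (chartAt H x₀).source) (w : E) :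
    chartDeriv I x₀ x (constField I x₀ w x) = w :=
  Trivialization.continuousLinearMapAt_symmL _ (by simpa using hx) w

@[simp]
lemma constField_chartDeriv {x₀ x : M} (hx : x ∈ (chartAt H x₀).source)
    (v : TangentSpace I x) : constField I x₀ (chartDeriv I x₀ x v) x = v :=
  Trivialization.symmL_continuousLinearMapAt _ (by simpa using hx) v

/-- The derivative along `constField I x₀ A` is a directional derivative in the chart. -/
lemma mvfderiv_constField {x₀ : M} {f : E → ℝ} (hf : DifferentiableAt ℝ f (extChartAt I x₀ x₀)) {h : M → ℝ}
    (hh : h =ᶠ[𝓝 x₀] f ∘ extChartAt I x₀) (A : E) :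
    mvfderiv I h x₀ (constField I x₀ A x₀) = fderiv ℝ f (extChartAt I x₀ x₀) A := by
  have h1 : mvfderiv I h x₀ = mvfderiv I (f ∘ extChartAt I x₀) x₀ := by
    rw [mvfderiv, mvfderiv, hh.mfderiv_eq, hh.self_of_nhds]
  have h2 := mvfderiv_comp_apply (I := 𝓘(ℝ, E)) (I' := I) x₀ hf.mdifferentiableAt
    (mdifferentiableAt_extChartAt (I := I) (mem_chart_source H x₀)) (constField I x₀ A x₀)
  have h3 : mfderiv I 𝓘(ℝ, E) (extChartAt I x₀) x₀ (constField I x₀ A x₀) = A := by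
    rw [← chartDeriv_eq_mfderiv (mem_chart_source H x₀)]
    exact chartDeriv_constField (mem_chart_source H x₀) A
  rw [h3, mvfderiv, mvfderiv, mfderiv_eq_fderiv] at h2
  rw [h1]
  exact h2

/-- The components of the metric in the chart at `x₀`. -/
def metricCoord (g : RiemMetric I M) (x₀ : M) (p : E) : E →L[ℝ] E →L[ℝ] ℝ :=
  ContinuousLinearMap.inCoordinates E (fun x : M ↦ TangentSpace I x) (E →L[ℝ] ℝ)
    (fun x : M ↦ TangentSpace I x →L[ℝ] Bundle.Trivial M ℝ x)
    x₀ ((extChartAt I x₀).symm p) x₀ ((extChartAt I x₀).symm p) (g.inner ((extChartAt I x₀).symm p))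

lemma metricCoord_apply (g : RiemMetric I M) {x₀ x : M} (hx : x ∈ (chartAt H x₀).source) (v w : E) :
    metricCoord g x₀ (extChartAt I x₀ x) v w =
      g.inner x (constField I x₀ v x) (constField I x₀ w x) := by
  have hx' : x ∈ (trivializationAt E (fun x : M ↦ TangentSpace I x) x₀).baseSet := by simpa using hx
  rw [metricCoord, (extChartAt I x₀).left_inv (by simpa using hx),
    inCoordinates_apply_eq₂ hx' hx' (Set.mem_univ _)]
  rw [constField, constField, Trivialization.symmL_apply _ hx', Trivialization.symmL_apply _ hx']
  simp

/-- The components of a vector field in the chart at `x₀`. -/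
def fieldCoord (I : ModelWithCorners ℝ E H) [IsManifold I ∞ M] (X : ∀ x : M, TangentSpace I x)
    (x₀ : M) (p : E) : E :=
  (trivializationAt E (fun x : M ↦ TangentSpace I x) x₀
    ⟨(extChartAt I x₀).symm p, X ((extChartAt I x₀).symm p)⟩).2

lemma fieldCoord_apply (X : ∀ x : M, TangentSpace I x) {x₀ x : M}
    (hx : x ∈ (chartAt H x₀).source) :
    fieldCoord I X x₀ (extChartAt I x₀ x) = chartDeriv I x₀ x (X x) := by
  have hx' : x ∈ (trivializationAt E (fun x : M ↦ TangentSpace I x) x₀).baseSet := by simpa using hx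
  rw [chartDeriv, fieldCoord,
    (extChartAt I x₀).left_inv (by simpa using hx)]
  exact (Trivialization.continuousLinearMapAt_apply_of_mem (R := ℝ) _ hx' _).symm

lemma metricCoord_symm (g : RiemMetric I M) {x₀ x : M} (hx : x ∈ (chartAt H x₀).source) (v w : E) :
    metricCoord g x₀ (extChartAt I x₀ x) v w = metricCoord g x₀ (extChartAt I x₀ x) w v := by
  rw [metricCoord_apply g hx, metricCoord_apply g hx, g.symm]

lemma metricCoord_chartDeriv (g : RiemMetric I M) {x₀ x : M} (hx : x ∈ (chartAt H x₀).source)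
    (v w : TangentSpace I x) :
    metricCoord g x₀ (extChartAt I x₀ x) (chartDeriv I x₀ x v) (chartDeriv I x₀ x w) =
      g.inner x v w := by
  rw [metricCoord_apply g hx, constField_chartDeriv hx, constField_chartDeriv hx]

lemma constField_fieldCoord_self (X : ∀ x : M, TangentSpace I x) (x₀ : M) :
    constField I x₀ (fieldCoord I X x₀ (extChartAt I x₀ x₀)) x₀ = X x₀ := by
  rw [fieldCoord_apply X (mem_chart_source H x₀), constField_chartDeriv (mem_chart_source H x₀)]

variable {V : Type*} [NormedAddCommGroup V] [NormedSpace ℝ V] {u : V → M} {v₀ : V}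

/-- Replaces `u` by its coordinate expression on a whole neighbourhood, so that functions built from
`du` can be differentiated once more. -/
lemma eventually_chartDeriv_mfderiv (hu : ContMDiffAt 𝓘(ℝ, V) I ∞ u v₀) :
    ∀ᶠ v in 𝓝 v₀, u v ∈ (chartAt H (u v₀)).source ∧ ∀ b : V,
      chartDeriv I (u v₀) (u v) (mfderiv 𝓘(ℝ, V) I u v b) =
        fderiv ℝ (extChartAt I (u v₀) ∘ u) v b := by
  have h1 : ContMDiffAt 𝓘(ℝ, V) I 1 u v₀ := hu.of_le (by exact_mod_cast le_top)
  filter_upwards [hu.continuousAt.eventually (eventually_mem_chartAt_source (H := H) (u v₀)),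
    (contMDiffAt_iff_contMDiffAt_nhds (by simp)).1 h1] with v hv h
  refine ⟨hv, fun b ↦ ?_⟩
  rw [← mfderiv_eq_fderiv, mfderiv_comp v (mdifferentiableAt_extChartAt hv)
    (h.mdifferentiableAt (by simp)), chartDeriv_eq_mfderiv hv]
  rfl

omit [IsManifold I ∞ M] in
lemma contDiffAt_extChartAt_comp (hu : ContMDiffAt 𝓘(ℝ, V) I ∞ u v₀) :
    ContDiffAt ℝ ∞ (extChartAt I (u v₀) ∘ u) v₀ :=
  ((contMDiffAt_extChartAt (x := u v₀)).comp v₀ hu).contDiffAt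

variable [I.Boundaryless]

/-- Pulled back by the inverse chart, both fields become constant maps near the base point, and
constant fields commute. -/
lemma mlieBracket_constField (x₀ : M) (v w : E) :
    VectorField.mlieBracket I (constField I x₀ v) (constField I x₀ w) x₀ = 0 := by
  have key : ∀ w : E, ∀ p ∈ (extChartAt I x₀).target,
      VectorField.mpullbackWithin 𝓘(ℝ, E) I (extChartAt I x₀).symm (constField I x₀ w)
        (Set.range I) p = w := by
    intro w p hp
    have hs : (extChartAt I x₀).symm p ∈ (chartAt H x₀).source := by
      rw [← extChartAt_source I]; exact (extChartAt I x₀).map_target hp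
    have := TangentBundle.symmL_trivializationAt (I := I) hs
    have hv : constField I x₀ w ((extChartAt I x₀).symm p) =
        mfderivWithin 𝓘(ℝ, E) I (extChartAt I x₀).symm (Set.range I) p w := by
      rw [(extChartAt I x₀).right_inv hp] at this
      rw [← this]; rfl
    rw [VectorField.mpullbackWithin_apply, hv]
    exact ContinuousLinearMap.IsInvertible.inverse_apply_eq
      (isInvertible_mfderivWithin_extChartAt_symm hp) |>.2 rfl
  have hev : ∀ w : E, VectorField.mpullbackWithin 𝓘(ℝ, E) I (extChartAt I x₀).symm
      (constField I x₀ w) (Set.range I) =ᶠ[𝓝 (extChartAt I x₀ x₀)] fun _ ↦ w := fun w ↦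
    Filter.eventually_of_mem (extChartAt_target_mem_nhds x₀) (key w)
  have h0 : VectorField.lieBracketWithin ℝ
      (VectorField.mpullbackWithin 𝓘(ℝ, E) I (extChartAt I x₀).symm (constField I x₀ v)
        (Set.range I) : E → E)
      (VectorField.mpullbackWithin 𝓘(ℝ, E) I (extChartAt I x₀).symm (constField I x₀ w)
        (Set.range I) : E → E)
      ((extChartAt I x₀).symm ⁻¹' Set.univ ∩ Set.range I) (extChartAt I x₀ x₀) = 0 := by
    rw [Filter.EventuallyEq.lieBracketWithin_vectorField_eq_nhds (hev v) (hev w)]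
    simp [VectorField.lieBracketWithin]
  rw [VectorField.mlieBracket, VectorField.mlieBracketWithin_apply]
  exact (congrArg _ h0).trans (map_zero _)

lemma contMDiffAt_extChartAt_symm_self (x₀ : M) :
    ContMDiffAt 𝓘(ℝ, E) I ∞ (extChartAt I x₀).symm (extChartAt I x₀ x₀) :=
  (contMDiffOn_extChartAt_symm x₀).contMDiffAt (extChartAt_target_mem_nhds x₀)

lemma contDiffAt_metricCoord (g : RiemMetric I M) (x₀ : M) :
    ContDiffAt ℝ ∞ (metricCoord g x₀) (extChartAt I x₀ x₀) := by
  have h := ((contMDiffAt_hom_bundle _).1 (g.contMDiff.contMDiffAt (x := x₀))).2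
  rw [← contMDiffAt_iff_contDiffAt]
  exact ContMDiffAt.comp_of_eq h (contMDiffAt_extChartAt_symm_self x₀) (by simp)

lemma contDiffAt_fieldCoord {X : ∀ x : M, TangentSpace I x} {x₀ : M}
    (hX : ContMDiffAt I (I.prod 𝓘(ℝ, E)) ∞
      (fun y ↦ TotalSpace.mk' E (E := fun x : M ↦ TangentSpace I x) y (X y)) x₀) :
    ContDiffAt ℝ ∞ (fieldCoord I X x₀) (extChartAt I x₀ x₀) := by
  have h := (contMDiffAt_section (F := E) (E := fun x : M ↦ TangentSpace I x) x₀).1 hX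
  rw [← contMDiffAt_iff_contDiffAt]
  exact ContMDiffAt.comp_of_eq (g := fun x ↦ (trivializationAt E (fun x : M ↦ TangentSpace I x) x₀
    ⟨x, X x⟩).2) h (contMDiffAt_extChartAt_symm_self x₀) (by simp)

end ConstantFields

/-! ### The Levi-Civita connection in coordinates and along maps -/

section LeviCivita

variable {V : Type*} [NormedAddCommGroup V] [NormedSpace ℝ V]
  {E : Type*} [NormedAddCommGroup E] [NormedSpace ℝ E]

set_option synthInstance.maxHeartbeats 400000 in
lemma hasFDerivAt_bilinear_apply {B : E → E →L[ℝ] E →L[ℝ] ℝ} {f : V → E} {s t : V → E} {v : V}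
    (hB : DifferentiableAt ℝ B (f v)) (hf : DifferentiableAt ℝ f v)
    (hs : DifferentiableAt ℝ s v) (ht : DifferentiableAt ℝ t v) :
    ∃ L : V →L[ℝ] ℝ, HasFDerivAt (fun v ↦ B (f v) (s v) (t v)) L v ∧ ∀ a,
      L a = fderiv ℝ B (f v) (fderiv ℝ f v a) (s v) (t v) + B (f v) (fderiv ℝ s v a) (t v) +
        B (f v) (s v) (fderiv ℝ t v a) := by
  have h₀ : HasFDerivAt (fun v ↦ B (f v)) ((fderiv ℝ B (f v)).comp (fderiv ℝ f v)) v :=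
    HasFDerivAt.comp (G := E →L[ℝ] E →L[ℝ] ℝ) v hB.hasFDerivAt hf.hasFDerivAt
  have h₁ := h₀.clm_apply hs.hasFDerivAt
  refine ⟨_, h₁.clm_apply ht.hasFDerivAt, fun a ↦ ?_⟩
  simp
  ring

lemma differentiableAt_bilinear_apply {B : E → E →L[ℝ] E →L[ℝ] ℝ} {f : V → E} {s t : V → E} {v : V}
    (hB : DifferentiableAt ℝ B (f v)) (hf : DifferentiableAt ℝ f v)
    (hs : DifferentiableAt ℝ s v) (ht : DifferentiableAt ℝ t v) :
    DifferentiableAt ℝ (fun v ↦ B (f v) (s v) (t v)) v :=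
  (hasFDerivAt_bilinear_apply hB hf hs ht).choose_spec.1.differentiableAt

lemma fderiv_bilinear_apply {B : E → E →L[ℝ] E →L[ℝ] ℝ} {f : V → E} {s t : V → E} {v : V}
    (hB : DifferentiableAt ℝ B (f v)) (hf : DifferentiableAt ℝ f v)
    (hs : DifferentiableAt ℝ s v) (ht : DifferentiableAt ℝ t v) (a : V) :
    fderiv ℝ (fun v ↦ B (f v) (s v) (t v)) v a =
      fderiv ℝ B (f v) (fderiv ℝ f v a) (s v) (t v) + B (f v) (fderiv ℝ s v a) (t v) +
        B (f v) (s v) (fderiv ℝ t v a) := by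
  obtain ⟨L, hL, h⟩ := hasFDerivAt_bilinear_apply hB hf hs ht
  rw [hL.fderiv, h]

/-- The derivative of `B (f v) (X (f v)) (df b)` in the direction `a`. -/
lemma fderiv_bilinear_apply_fderiv {B : E → E →L[ℝ] E →L[ℝ] ℝ} {f : V → E} {X : E → E} {v : V}
    (hB : DifferentiableAt ℝ B (f v)) (hX : DifferentiableAt ℝ X (f v)) (hf : ContDiffAt ℝ ∞ f v)
    (a b : V) :
    fderiv ℝ (fun v ↦ B (f v) (X (f v)) (fderiv ℝ f v b)) v a =
      fderiv ℝ B (f v) (fderiv ℝ f v a) (X (f v)) (fderiv ℝ f v b) +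
        B (f v) (fderiv ℝ X (f v) (fderiv ℝ f v a)) (fderiv ℝ f v b) +
        B (f v) (X (f v)) (fderiv ℝ (fderiv ℝ f) v a b) := by
  have hf1 := hf.differentiableAt (by simp)
  have hf2 : DifferentiableAt ℝ (fderiv ℝ f) v :=
    (hf.fderiv_right (m := ∞) (by simp)).differentiableAt (by simp)
  have hX1 : DifferentiableAt ℝ (fun v ↦ X (f v)) v := hX.comp v hf1
  rw [fderiv_bilinear_apply hB hf1 hX1 (hf2.clm_apply (differentiableAt_const b)),
    fderiv_fun_comp v hX hf1, fderiv_clm_apply hf2 (differentiableAt_const b)]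
  simp

lemma fderiv_bilinear_fderiv_self {B : E → E →L[ℝ] E →L[ℝ] ℝ} {f : V → E} {v : V}
    (hB : DifferentiableAt ℝ B (f v)) (hf : ContDiffAt ℝ ∞ f v) (a c : V) :
    fderiv ℝ (fun v ↦ B (f v) (fderiv ℝ f v a) (fderiv ℝ f v a)) v c =
      fderiv ℝ B (f v) (fderiv ℝ f v c) (fderiv ℝ f v a) (fderiv ℝ f v a) +
        B (f v) (fderiv ℝ (fderiv ℝ f) v c a) (fderiv ℝ f v a) +
        B (f v) (fderiv ℝ f v a) (fderiv ℝ (fderiv ℝ f) v c a) := by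
  have hf1 := hf.differentiableAt (by simp)
  have hf2 : DifferentiableAt ℝ (fderiv ℝ f) v :=
    (hf.fderiv_right (m := ∞) (by simp)).differentiableAt (by simp)
  have hf3 := hf2.clm_apply (differentiableAt_const a)
  rw [fderiv_bilinear_apply hB hf1 hf3 hf3, fderiv_clm_apply hf2 (differentiableAt_const a)]
  simp

/-- If `X ∘ f = df c` on the line through `v` in the direction `a`, then `dX (df a) = d²f (a, c)`. -/
lemma fderiv_apply_fderiv_of_eq {f : V → E} {X : E → E} {v : V}
    (hX : DifferentiableAt ℝ X (f v)) (hf : ContDiffAt ℝ ∞ f v) (a c : V)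
    (h : ∀ᶠ t in 𝓝 (0 : ℝ), X (f (v + t • a)) = fderiv ℝ f (v + t • a) c) :
    fderiv ℝ X (f v) (fderiv ℝ f v a) = fderiv ℝ (fderiv ℝ f) v a c := by
  have hf1 := hf.differentiableAt (by simp)
  have hf2 : DifferentiableAt ℝ (fderiv ℝ f) v :=
    (hf.fderiv_right (m := ∞) (by simp)).differentiableAt (by simp)
  have h1 : HasLineDerivAt ℝ (X ∘ f) (fderiv ℝ X (f v) (fderiv ℝ f v a)) v a :=
    (hX.hasFDerivAt.comp v hf1.hasFDerivAt).hasLineDerivAt a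
  have h2 : HasLineDerivAt ℝ (fun v ↦ fderiv ℝ f v c) (fderiv ℝ (fderiv ℝ f) v a c) v a := by
    simpa using (hf2.hasFDerivAt.clm_apply (hasFDerivAt_const c v)).hasLineDerivAt a
  exact HasDerivAt.unique h1 (HasDerivAt.congr_of_eventuallyEq h2 h)

variable [FiniteDimensional ℝ E] [CompleteSpace E]
  {H : Type*} [TopologicalSpace H] {I : ModelWithCorners ℝ E H} [I.Boundaryless]
  {M : Type*} [TopologicalSpace M] [ChartedSpace H M] [IsManifold I ∞ M]
  {g : RiemMetric I M} {cov : CovariantDerivative I E (fun x : M ↦ TangentSpace I x)}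

/-- Symmetry of the Christoffel symbols: the torsion vanishes and coordinate fields commute. -/
lemma IsLeviCivita.cov_constField_comm (h : IsLeviCivita g cov) (x₀ : M)
    (v w : E) :
    cov (constField I x₀ w) x₀ (constField I x₀ v x₀) =
      cov (constField I x₀ v) x₀ (constField I x₀ w x₀) := by
  have := (cov.torsion_eq_zero_iff.1 h.2) (mdifferentiableAt_constField x₀ v)
    (mdifferentiableAt_constField x₀ w)
  rw [mlieBracket_constField] at this
  exact sub_eq_zero.1 this

/-- Metric compatibility applied to coordinate fields; it trades derivatives of the metric
coefficients for Christoffel terms. -/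
lemma IsLeviCivita.fderiv_metricCoord (h : IsLeviCivita g cov) (x₀ : M) (a v w : E) :
    fderiv ℝ (metricCoord g x₀) (extChartAt I x₀ x₀) a v w =
      g.inner x₀ (cov (constField I x₀ v) x₀ (constField I x₀ a x₀)) (constField I x₀ w x₀) +
      g.inner x₀ (constField I x₀ v x₀) (cov (constField I x₀ w) x₀ (constField I x₀ a x₀)) := by
  have hG : DifferentiableAt ℝ (metricCoord g x₀) (extChartAt I x₀ x₀) :=
    (contDiffAt_metricCoord g x₀).differentiableAt (by simp)
  rw [← h.1 x₀ _ _ _ (mdifferentiableAt_constField x₀ v) (mdifferentiableAt_constField x₀ w)]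
  have := fderiv_bilinear_apply (f := id) hG differentiableAt_id (differentiableAt_const v) (differentiableAt_const w) a
  rw [mvfderiv_constField (f := fun p ↦ metricCoord g x₀ p v w)
    ((hG.clm_apply (differentiableAt_const v)).clm_apply (differentiableAt_const w))]
  · erw [this]; simp
  · filter_upwards [eventually_mem_chartAt_source (H := H) x₀] with x hx
    exact (metricCoord_apply g hx v w).symm

/-- The coordinate expression of the covariant derivative of a vector field, paired with a vector. -/
lemma IsLeviCivita.inner_cov_eq (h : IsLeviCivita g cov) {X : ∀ x : M, TangentSpace I x} {x₀ : M}
    (hX : ContMDiffAt I (I.prod 𝓘(ℝ, E)) ∞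
      (fun y ↦ TotalSpace.mk' E (E := fun x : M ↦ TangentSpace I x) y (X y)) x₀) (a w : E) :
    g.inner x₀ (cov X x₀ (constField I x₀ a x₀)) (constField I x₀ w x₀) =
      g.inner x₀ (cov (constField I x₀ (fieldCoord I X x₀ (extChartAt I x₀ x₀))) x₀
          (constField I x₀ a x₀)) (constField I x₀ w x₀) +
      metricCoord g x₀ (extChartAt I x₀ x₀)
        (fderiv ℝ (fieldCoord I X x₀) (extChartAt I x₀ x₀) a) w := by
  have hG : DifferentiableAt ℝ (metricCoord g x₀) (extChartAt I x₀ x₀) :=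
    (contDiffAt_metricCoord g x₀).differentiableAt (by simp)
  have hC := (contDiffAt_fieldCoord hX).differentiableAt (by simp)
  -- Compatibility is applied to `X` and a coordinate field. Comparing with the product rule for the
  -- coefficients isolates the covariant derivative of `X`, without expanding `X` in a frame.
  have h1 := h.1 x₀ (constField I x₀ a x₀) _ _ (hX.mdifferentiableAt (by simp))
    (mdifferentiableAt_constField x₀ w)
  rw [mvfderiv_constField (f := fun p ↦ metricCoord g x₀ (id p) (fieldCoord I X x₀ p) w)
    ((hG.clm_apply hC).clm_apply (differentiableAt_const w)),
    fderiv_bilinear_apply (f := id) hG differentiableAt_id hC (differentiableAt_const w)] at h1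
  · simp only [fderiv_fun_const, Pi.zero_apply, zero_apply, map_zero,
      add_zero, fderiv_id, ContinuousLinearMap.id_apply, id] at h1
    rw [h.fderiv_metricCoord, constField_fieldCoord_self] at h1
    linarith
  · filter_upwards [eventually_mem_chartAt_source (H := H) x₀] with x hx
    simp only [Function.comp, id]
    rw [metricCoord_apply g hx, fieldCoord_apply X hx, constField_chartDeriv hx]

section Maps

variable {u : V → M} {v₀ : V}

omit [FiniteDimensional ℝ E] [CompleteSpace E] in
lemma differentiableAt_inner_mfderiv (g : RiemMetric I M) {X : ∀ x : M, TangentSpace I x}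
    (hX : ContMDiffAt I (I.prod 𝓘(ℝ, E)) ∞
      (fun y ↦ TotalSpace.mk' E (E := fun x : M ↦ TangentSpace I x) y (X y)) (u v₀))
    (hu : ContMDiffAt 𝓘(ℝ, V) I ∞ u v₀) (b : V) :
    DifferentiableAt ℝ (fun v ↦ g.inner (u v) (X (u v)) (mfderiv 𝓘(ℝ, V) I u v b)) v₀ := by
  have hû := contDiffAt_extChartAt_comp (I := I) hu
  have hû1 := hû.differentiableAt (by simp)
  have hû2 : DifferentiableAt ℝ (fderiv ℝ (extChartAt I (u v₀) ∘ u)) v₀ :=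
    (hû.fderiv_right (m := ∞) (by simp)).differentiableAt (by simp)
  have hX1 : DifferentiableAt ℝ (fun v ↦ fieldCoord I X (u v₀) ((extChartAt I (u v₀) ∘ u) v)) v₀ :=
    DifferentiableAt.comp (g := fieldCoord I X (u v₀)) v₀
      ((contDiffAt_fieldCoord hX).differentiableAt (by simp)) hû1
  refine (differentiableAt_bilinear_apply (f := extChartAt I (u v₀) ∘ u)
    ((contDiffAt_metricCoord g (u v₀)).differentiableAt (by simp)) hû1 hX1
    (hû2.clm_apply (differentiableAt_const b))).congr_of_eventuallyEq ?_
  filter_upwards [eventually_chartDeriv_mfderiv (I := I) hu] with v hv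
  rw [Function.comp, fieldCoord_apply X hv.1, ← hv.2 b, metricCoord_chartDeriv g hv.1]

omit [FiniteDimensional ℝ E] [CompleteSpace E] in
lemma differentiableAt_inner_mfderiv_self (g : RiemMetric I M) (hu : ContMDiffAt 𝓘(ℝ, V) I ∞ u v₀)
    (a : V) :
    DifferentiableAt ℝ
      (fun v ↦ g.inner (u v) (mfderiv 𝓘(ℝ, V) I u v a) (mfderiv 𝓘(ℝ, V) I u v a)) v₀ := by
  have hû := contDiffAt_extChartAt_comp (I := I) hu
  have hû2 : DifferentiableAt ℝ (fderiv ℝ (extChartAt I (u v₀) ∘ u)) v₀ :=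
    (hû.fderiv_right (m := ∞) (by simp)).differentiableAt (by simp)
  have hû3 := hû2.clm_apply (differentiableAt_const a)
  refine (differentiableAt_bilinear_apply (f := extChartAt I (u v₀) ∘ u)
    ((contDiffAt_metricCoord g (u v₀)).differentiableAt (by simp))
    (hû.differentiableAt (by simp)) hû3 hû3).congr_of_eventuallyEq ?_
  filter_upwards [eventually_chartDeriv_mfderiv (I := I) hu] with v hv
  rw [Function.comp, ← hv.2 a, metricCoord_chartDeriv g hv.1]

/-- The exterior derivative of the 1-form dual to `X`, pulled back along the map `u`. -/
lemma IsLeviCivita.fderiv_inner_sub (h : IsLeviCivita g cov) {X : ∀ x : M, TangentSpace I x}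
    (hX : ContMDiffAt I (I.prod 𝓘(ℝ, E)) ∞
      (fun y ↦ TotalSpace.mk' E (E := fun x : M ↦ TangentSpace I x) y (X y)) (u v₀))
    (hu : ContMDiffAt 𝓘(ℝ, V) I ∞ u v₀) (a b : V) :
    fderiv ℝ (fun v ↦ g.inner (u v) (X (u v)) (mfderiv 𝓘(ℝ, V) I u v b)) v₀ a -
      fderiv ℝ (fun v ↦ g.inner (u v) (X (u v)) (mfderiv 𝓘(ℝ, V) I u v a)) v₀ b =
    g.inner (u v₀) (cov X (u v₀) (mfderiv 𝓘(ℝ, V) I u v₀ a)) (mfderiv 𝓘(ℝ, V) I u v₀ b) -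
      g.inner (u v₀) (cov X (u v₀) (mfderiv 𝓘(ℝ, V) I u v₀ b)) (mfderiv 𝓘(ℝ, V) I u v₀ a) := by
  have hû := contDiffAt_extChartAt_comp (I := I) hu
  have hsym := hû.isSymmSndFDerivAt (by
    rw [minSmoothness_of_isRCLikeNormedField]; exact WithTop.coe_le_coe.2 (le_top : (2 : ℕ∞) ≤ ⊤)) a b
  have hD := eventually_chartDeriv_mfderiv (I := I) hu
  -- Besides the covariant derivative term, the product rule leaves a Christoffel term and a second
  -- derivative of the coordinate map. Both are symmetric in `a` and `b`, so they drop out of the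
  -- difference.
  have key : ∀ a b : V,
      fderiv ℝ (fun v ↦ g.inner (u v) (X (u v)) (mfderiv 𝓘(ℝ, V) I u v b)) v₀ a =
      g.inner (u v₀) (cov X (u v₀) (mfderiv 𝓘(ℝ, V) I u v₀ a)) (mfderiv 𝓘(ℝ, V) I u v₀ b) +
      g.inner (u v₀) (X (u v₀)) (cov (constField I (u v₀) (chartDeriv I (u v₀) (u v₀)
        (mfderiv 𝓘(ℝ, V) I u v₀ b))) (u v₀) (mfderiv 𝓘(ℝ, V) I u v₀ a)) +
      metricCoord g (u v₀) (extChartAt I (u v₀) (u v₀))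
        (fieldCoord I X (u v₀) (extChartAt I (u v₀) (u v₀)))
        (fderiv ℝ (fderiv ℝ (extChartAt I (u v₀) ∘ u)) v₀ a b) := by
    intro a b
    have hev : (fun v ↦ g.inner (u v) (X (u v)) (mfderiv 𝓘(ℝ, V) I u v b)) =ᶠ[𝓝 v₀]
        fun v ↦ metricCoord g (u v₀) ((extChartAt I (u v₀) ∘ u) v)
          (fieldCoord I X (u v₀) ((extChartAt I (u v₀) ∘ u) v))
          (fderiv ℝ (extChartAt I (u v₀) ∘ u) v b) := by
      filter_upwards [hD] with v hv
      rw [Function.comp, fieldCoord_apply X hv.1, ← hv.2 b, metricCoord_chartDeriv g hv.1]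
    rw [hev.fderiv_eq, fderiv_bilinear_apply_fderiv (f := extChartAt I (u v₀) ∘ u)
      ((contDiffAt_metricCoord g (u v₀)).differentiableAt (by simp))
      ((contDiffAt_fieldCoord hX).differentiableAt (by simp)) hû, ← hD.self_of_nhds.2,
      ← hD.self_of_nhds.2, Function.comp, h.fderiv_metricCoord, constField_fieldCoord_self]
    have hs := mem_chart_source H (u v₀)
    have h4 := h.inner_cov_eq hX (chartDeriv I (u v₀) (u v₀) (mfderiv 𝓘(ℝ, V) I u v₀ a))
      (chartDeriv I (u v₀) (u v₀) (mfderiv 𝓘(ℝ, V) I u v₀ b))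
    rw [constField_chartDeriv hs, constField_chartDeriv hs] at h4 ⊢
    rw [h4]
    ring
  rw [key, key, hsym]
  have h5 := h.cov_constField_comm (u v₀)
    (chartDeriv I (u v₀) (u v₀) (mfderiv 𝓘(ℝ, V) I u v₀ a))
    (chartDeriv I (u v₀) (u v₀) (mfderiv 𝓘(ℝ, V) I u v₀ b))
  have hs := mem_chart_source H (u v₀)
  rw [constField_chartDeriv hs, constField_chartDeriv hs] at h5
  rw [h5]
  ring

/-- A substitute for `∇_c (du a) = ∇_a (du c) = ∇_{du a} X`. Only the derivative of `X` in the
direction `du a` enters, hence `X = du c` is required only on the line in the direction `a`. -/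
lemma IsLeviCivita.fderiv_inner_mfderiv_self (h : IsLeviCivita g cov)
    {X : ∀ x : M, TangentSpace I x}
    (hX : ContMDiffAt I (I.prod 𝓘(ℝ, E)) ∞
      (fun y ↦ TotalSpace.mk' E (E := fun x : M ↦ TangentSpace I x) y (X y)) (u v₀))
    (hu : ContMDiffAt 𝓘(ℝ, V) I ∞ u v₀) (a c : V)
    (hc : ∀ᶠ t in 𝓝 (0 : ℝ), X (u (v₀ + t • a)) = mfderiv 𝓘(ℝ, V) I u (v₀ + t • a) c) :
    fderiv ℝ (fun v ↦ g.inner (u v) (mfderiv 𝓘(ℝ, V) I u v a) (mfderiv 𝓘(ℝ, V) I u v a)) v₀ c =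
      2 * g.inner (u v₀) (cov X (u v₀) (mfderiv 𝓘(ℝ, V) I u v₀ a)) (mfderiv 𝓘(ℝ, V) I u v₀ a) := by
  have hs := mem_chart_source H (u v₀)
  have hû := contDiffAt_extChartAt_comp (I := I) hu
  have hD := eventually_chartDeriv_mfderiv (I := I) hu
  have hXd := (contDiffAt_fieldCoord hX).differentiableAt (by simp)
  have hG := (contDiffAt_metricCoord g (u v₀)).differentiableAt (by simp)
  have hev : (fun v ↦ g.inner (u v) (mfderiv 𝓘(ℝ, V) I u v a) (mfderiv 𝓘(ℝ, V) I u v a)) =ᶠ[𝓝 v₀]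
      fun v ↦ metricCoord g (u v₀) ((extChartAt I (u v₀) ∘ u) v)
        (fderiv ℝ (extChartAt I (u v₀) ∘ u) v a) (fderiv ℝ (extChartAt I (u v₀) ∘ u) v a) := by
    filter_upwards [hD] with v hv
    rw [Function.comp, ← hv.2 a, metricCoord_chartDeriv g hv.1]
  have hline : Filter.Tendsto (fun t : ℝ ↦ v₀ + t • a) (𝓝 0) (𝓝 v₀) :=
    Continuous.tendsto' (by fun_prop) _ _ (by simp)
  -- The mixed second derivative of the coordinate map is rewritten as the derivative of the
  -- components of `X`, which is the non-Christoffel part of `∇_{du a} X`.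
  have h1 := fderiv_apply_fderiv_of_eq (f := extChartAt I (u v₀) ∘ u) (X := fieldCoord I X (u v₀)) hXd hû a c (by
    filter_upwards [hc, hline.eventually hD] with t ht hv
    rw [← hv.2 c, ← ht, Function.comp, fieldCoord_apply X hv.1])
  have hc0 : X (u v₀) = mfderiv 𝓘(ℝ, V) I u v₀ c := by
    have := hc.self_of_nhds
    rwa [zero_smul, add_zero] at this
  have h4 := h.inner_cov_eq hX (chartDeriv I (u v₀) (u v₀) (mfderiv 𝓘(ℝ, V) I u v₀ a))
    (chartDeriv I (u v₀) (u v₀) (mfderiv 𝓘(ℝ, V) I u v₀ a))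
  have h5 := h.cov_constField_comm (u v₀)
    (chartDeriv I (u v₀) (u v₀) (mfderiv 𝓘(ℝ, V) I u v₀ a))
    (chartDeriv I (u v₀) (u v₀) (mfderiv 𝓘(ℝ, V) I u v₀ c))
  have hsym := hû.isSymmSndFDerivAt (by
    rw [minSmoothness_of_isRCLikeNormedField]; exact WithTop.coe_le_coe.2 (le_top : (2 : ℕ∞) ≤ ⊤))
    a c
  rw [fieldCoord_apply X hs, constField_chartDeriv hs, hc0] at h4
  rw [constField_chartDeriv hs, constField_chartDeriv hs] at h5
  rw [← hD.self_of_nhds.2] at h1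
  have h6 := metricCoord_symm g (mem_chart_source H (u v₀))
    (fderiv ℝ (fieldCoord I X (u v₀)) (extChartAt I (u v₀) (u v₀))
      (chartDeriv I (u v₀) (u v₀) (mfderiv 𝓘(ℝ, V) I u v₀ a)))
    (chartDeriv I (u v₀) (u v₀) (mfderiv 𝓘(ℝ, V) I u v₀ a))
  rw [hev.fderiv_eq, fderiv_bilinear_fderiv_self (f := extChartAt I (u v₀) ∘ u) hG hû,
    ← hsym, ← h1, ← hD.self_of_nhds.2, ← hD.self_of_nhds.2, Function.comp,
    h.fderiv_metricCoord, constField_chartDeriv hs, constField_chartDeriv hs, h4, h5, ← h6,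
    g.symm _ _ (cov _ _ _)]
  ring

end Maps

end LeviCivita

/-! ### The covariant derivative of `ξ` and its two consequences -/

section AlmostContact

variable {E : Type*} [NormedAddCommGroup E] [NormedSpace ℝ E]
  {H : Type*} [TopologicalSpace H] {I : ModelWithCorners ℝ E H}
  {M : Type*} [TopologicalSpace M] [ChartedSpace H M] [IsManifold I ∞ M]

namespace AlmostContactMetric

variable (S : AlmostContactMetric I M) {x : M}

/-- Put `ξ` in the compatibility of `g` with `φ`: the left side vanishes because `φ ξ = 0`. -/
lemma η_eq (v : TangentSpace I x) : S.η x v = S.g.inner x (S.ξ x) v := by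
  have := S.g_φ_φ x (S.ξ x) v
  rw [S.φ_ξ, map_zero, zero_apply, S.η_ξ] at this
  linarith

lemma g_ξ_ξ : S.g.inner x (S.ξ x) (S.ξ x) = 1 := by
  rw [← S.η_eq, S.η_ξ]

/-- Skew-symmetry of `φ`, from the compatibility identity at `φ v` and `w` together with the formula
for `φ²`. -/
lemma g_φ_left (v w : TangentSpace I x) :
    S.g.inner x (S.φ x v) w = -S.g.inner x (S.φ x w) v := by
  have h := S.g_φ_φ x (S.φ x v) w
  rw [S.φ_φ, S.η_φ, map_add, map_neg, map_smul, add_apply, neg_apply, smul_apply, ← S.η_eq,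
    S.η_φ, S.g.symm x v] at h
  simpa using h.symm

lemma g_φ_self (v : TangentSpace I x) : S.g.inner x (S.φ x v) v = 0 := by
  have := S.g_φ_left v v
  linarith

end AlmostContactMetric

variable [FiniteDimensional ℝ E] [CompleteSpace E] {S : AlmostContactMetric I M} {α β : M → ℝ}

/-- On a trans-Sasakian manifold, `∇_v ξ = -α φ v + β (v - η(v) ξ)`. -/
lemma IsTransSasakian.exists_cov_ξ (hS : IsTransSasakian S α β) :
    ∃ cov : CovariantDerivative I E (fun x : M ↦ TangentSpace I x), IsLeviCivita S.g cov ∧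
      ∀ (x : M) (v : TangentSpace I x),
        cov S.ξ x v = -(α x • S.φ x v) + β x • (v - S.η x v • S.ξ x) := by
  obtain ⟨-, -, cov, hcov, h⟩ := hS
  refine ⟨cov, hcov, fun x v ↦ ?_⟩
  have hξ : MDifferentiableAt I (I.prod 𝓘(ℝ, E))
      (fun y ↦ TotalSpace.mk' E (E := fun x : M ↦ TangentSpace I x) y (S.ξ y)) x :=
    (S.contMDiff_ξ x).mdifferentiableAt (by simp)
  have h1 := h x v S.ξ hξ
  have h0 : (fun y ↦ S.φ y (S.ξ y)) = 0 := funext fun y ↦ S.φ_ξ y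
  rw [h0, cov.zero, S.η_ξ, S.g.symm x v, ← S.η_eq, S.g.symm x (S.φ x v), ← S.η_eq, S.η_φ] at h1
  -- The field `ξ` has constant length, so its covariant derivative is orthogonal to it.
  have h2 : S.η x (cov S.ξ x v) = 0 := by
    have h3 := hcov.1 x v _ _ hξ hξ
    have h4 : (fun y ↦ S.g.inner y (S.ξ y) (S.ξ y)) = fun _ ↦ (1 : ℝ) :=
      funext fun y ↦ S.g_ξ_ξ
    rw [h4, mvfderiv_const, S.g.symm x (cov S.ξ x v), ← S.η_eq] at h3
    simp at h3
    linarith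
  -- The structure equation at `Y = ξ` determines only `φ (∇_v ξ)`. Applying `φ` again recovers `∇_v
  -- ξ`, as its `ξ`-component is zero by `h2`.
  have h5 := congrArg (S.φ x) h1
  simp only [map_sub, map_add, map_smul, Pi.zero_apply, zero_apply, S.φ_φ, S.φ_ξ, h2] at h5
  simp only [zero_smul, smul_zero, zero_sub, map_zero, one_smul, add_zero, neg_neg] at h5
  rw [h5]
  module

variable [I.Boundaryless] {V : Type*} [NormedAddCommGroup V] [NormedSpace ℝ V] {u : V → M} {v₀ : V}

omit [FiniteDimensional ℝ E] [CompleteSpace E] in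
lemma AlmostContactMetric.differentiableAt_η_mfderiv (S : AlmostContactMetric I M)
    (hu : ContMDiffAt 𝓘(ℝ, V) I ∞ u v₀) (b : V) :
    DifferentiableAt ℝ (fun v ↦ S.η (u v) (mfderiv 𝓘(ℝ, V) I u v b)) v₀ := by
  simp only [S.η_eq]
  exact differentiableAt_inner_mfderiv S.g (S.contMDiff_ξ _) hu b

/-- The exterior derivative of `η`, pulled back along a map, is `dη(X, Y) = -2 α g(φ X, Y)`. -/
lemma IsTransSasakian.fderiv_η_sub (hS : IsTransSasakian S α β)
    (hu : ContMDiffAt 𝓘(ℝ, V) I ∞ u v₀) (a b : V) :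
    fderiv ℝ (fun v ↦ S.η (u v) (mfderiv 𝓘(ℝ, V) I u v b)) v₀ a -
      fderiv ℝ (fun v ↦ S.η (u v) (mfderiv 𝓘(ℝ, V) I u v a)) v₀ b =
    -2 * α (u v₀) * S.g.inner (u v₀) (S.φ (u v₀) (mfderiv 𝓘(ℝ, V) I u v₀ a))
      (mfderiv 𝓘(ℝ, V) I u v₀ b) := by
  obtain ⟨cov, hcov, hξ⟩ := hS.exists_cov_ξ
  simp only [S.η_eq]
  rw [hcov.fderiv_inner_sub (S.contMDiff_ξ _) hu, hξ, hξ]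
  have h1 := S.g_φ_left (mfderiv 𝓘(ℝ, V) I u v₀ b) (mfderiv 𝓘(ℝ, V) I u v₀ a)
  have h2 := S.g.symm _ (mfderiv 𝓘(ℝ, V) I u v₀ b) (mfderiv 𝓘(ℝ, V) I u v₀ a)
  simp only [map_add, map_neg, map_smul, map_sub, add_apply, neg_apply, smul_apply, sub_apply,
    smul_eq_mul, ← S.η_eq, h1, h2]
  ring

/-- If `ξ = du c` along a line in the direction `a`, then
`c (g (du a, du a)) = 2 β (g (du a, du a) - η (du a) ^ 2)`. -/
lemma IsTransSasakian.fderiv_inner_mfderiv_self (hS : IsTransSasakian S α β)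
    (hu : ContMDiffAt 𝓘(ℝ, V) I ∞ u v₀) (a c : V)
    (hc : ∀ᶠ t in 𝓝 (0 : ℝ), S.ξ (u (v₀ + t • a)) = mfderiv 𝓘(ℝ, V) I u (v₀ + t • a) c) :
    fderiv ℝ (fun v ↦ S.g.inner (u v) (mfderiv 𝓘(ℝ, V) I u v a) (mfderiv 𝓘(ℝ, V) I u v a)) v₀ c =
      2 * β (u v₀) * (S.g.inner (u v₀) (mfderiv 𝓘(ℝ, V) I u v₀ a) (mfderiv 𝓘(ℝ, V) I u v₀ a) -
        S.η (u v₀) (mfderiv 𝓘(ℝ, V) I u v₀ a) ^ 2) := by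
  obtain ⟨cov, hcov, hξ⟩ := hS.exists_cov_ξ
  rw [hcov.fderiv_inner_mfderiv_self (S.contMDiff_ξ _) hu a c hc, hξ]
  simp only [map_add, map_neg, map_smul, map_sub, add_apply, neg_apply, smul_apply, sub_apply,
    smul_eq_mul, ← S.η_eq, S.g_φ_self]
  ring

end AlmostContact

/-! ### The local argument on a product of domains in vector spaces -/

section LocalProduct

variable {E : Type*} [NormedAddCommGroup E] [NormedSpace ℝ E] [FiniteDimensional ℝ E]
  [CompleteSpace E] {H : Type*} [TopologicalSpace H] {I : ModelWithCorners ℝ E H} [I.Boundaryless]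
  {M : Type*} [TopologicalSpace M] [ChartedSpace H M] [IsManifold I ∞ M]
  {S : AlmostContactMetric I M} {α β : M → ℝ}
  {V₁ : Type*} [NormedAddCommGroup V₁] [NormedSpace ℝ V₁]
  {V₂ : Type*} [NormedAddCommGroup V₂] [NormedSpace ℝ V₂]

/-- A map from a product `O₁ × O₂` of domains in vector spaces, which pulls the metric back to the
doubly warped product metric `F₂² G₁ ⊕ F₁² G₂`, such that `φ` maps the second factor to vectors
orthogonal to the first one, and `ξ` is tangent to the first factor. -/
structure IsLocalWarped (S : AlmostContactMetric I M) (u : V₁ × V₂ → M) (O₁ : Set V₁) (O₂ : Set V₂)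
    (F₁ : V₁ → ℝ) (F₂ : V₂ → ℝ) (G₁ : V₁ → V₁ →ₗ[ℝ] V₁ →ₗ[ℝ] ℝ)
    (G₂ : V₂ → V₂ →ₗ[ℝ] V₂ →ₗ[ℝ] ℝ) : Prop where
  isOpen_fst : IsOpen O₁
  isOpen_snd : IsOpen O₂
  isPreconnected_snd : IsPreconnected O₂
  contMDiffAt : ∀ p ∈ O₁, ∀ q ∈ O₂, ContMDiffAt 𝓘(ℝ, V₁ × V₂) I ∞ u (p, q)
  F₁_pos : ∀ p ∈ O₁, 0 < F₁ p
  F₂_pos : ∀ q ∈ O₂, 0 < F₂ q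
  G₁_pos : ∀ p ∈ O₁, ∀ X : V₁, X ≠ 0 → 0 < G₁ p X X
  G₂_pos : ∀ q ∈ O₂, ∀ Z : V₂, Z ≠ 0 → 0 < G₂ q Z Z
  metric_eq : ∀ p ∈ O₁, ∀ q ∈ O₂, ∀ X Y : V₁ × V₂,
    S.g.inner (u (p, q)) (mfderiv 𝓘(ℝ, V₁ × V₂) I u (p, q) X)
      (mfderiv 𝓘(ℝ, V₁ × V₂) I u (p, q) Y) =
    F₂ q ^ 2 * G₁ p X.1 Y.1 + F₁ p ^ 2 * G₂ q X.2 Y.2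
  inner_φ : ∀ p ∈ O₁, ∀ q ∈ O₂, ∀ (X : V₁) (Z : V₂),
    S.g.inner (u (p, q)) (S.φ (u (p, q)) (mfderiv 𝓘(ℝ, V₁ × V₂) I u (p, q) ((0 : V₁), Z)))
      (mfderiv 𝓘(ℝ, V₁ × V₂) I u (p, q) (X, (0 : V₂))) = 0
  exists_ξ : ∀ p ∈ O₁, ∀ q ∈ O₂, ∃ X : V₁,
    mfderiv 𝓘(ℝ, V₁ × V₂) I u (p, q) (X, (0 : V₂)) = S.ξ (u (p, q))

namespace IsLocalWarped

variable {u : V₁ × V₂ → M} {O₁ : Set V₁} {O₂ : Set V₂} {F₁ : V₁ → ℝ} {F₂ : V₂ → ℝ}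
  {G₁ : V₁ → V₁ →ₗ[ℝ] V₁ →ₗ[ℝ] ℝ} {G₂ : V₂ → V₂ →ₗ[ℝ] V₂ →ₗ[ℝ] ℝ}

omit [FiniteDimensional ℝ E] [CompleteSpace E] [I.Boundaryless] in
lemma η_eq (h : IsLocalWarped S u O₁ O₂ F₁ F₂ G₁ G₂) {p : V₁} {q : V₂} (hp : p ∈ O₁) (hq : q ∈ O₂)
    {X : V₁} (hX : mfderiv 𝓘(ℝ, V₁ × V₂) I u (p, q) (X, (0 : V₂)) = S.ξ (u (p, q)))
    (Y : V₁ × V₂) :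
    S.η (u (p, q)) (mfderiv 𝓘(ℝ, V₁ × V₂) I u (p, q) Y) = F₂ q ^ 2 * G₁ p X Y.1 := by
  rw [S.η_eq, ← hX, h.metric_eq p hp q hq]
  simp

/-- The 1-form `η`, restricted to the first factor, does not depend on the second variable. -/
lemma η_mfderiv_eq (h : IsLocalWarped S u O₁ O₂ F₁ F₂ G₁ G₂) (hS : IsTransSasakian S α β)
    {p : V₁} (hp : p ∈ O₁) {q q' : V₂} (hq : q ∈ O₂) (hq' : q' ∈ O₂) (Y : V₁) :
    S.η (u (p, q)) (mfderiv 𝓘(ℝ, V₁ × V₂) I u (p, q) (Y, (0 : V₂))) =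
      S.η (u (p, q')) (mfderiv 𝓘(ℝ, V₁ × V₂) I u (p, q') (Y, (0 : V₂))) := by
  have hd : ∀ q ∈ O₂, HasFDerivAt (fun q ↦
      S.η (u (p, q)) (mfderiv 𝓘(ℝ, V₁ × V₂) I u (p, q) (Y, (0 : V₂)))) (0 : V₂ →L[ℝ] ℝ) q := by
    intro q hq
    have h1 := (S.differentiableAt_η_mfderiv (h.contMDiffAt p hp q hq) (Y, (0 : V₂))).hasFDerivAt
    have h2 := h1.comp q (hasFDerivAt_prodMk_right p q)
    convert! h2 using 1
    ext Z
    have h3 := hS.fderiv_η_sub (h.contMDiffAt p hp q hq) ((0 : V₁), Z) (Y, (0 : V₂))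
    rw [h.inner_φ p hp q hq] at h3
    -- As `η` kills the second factor near the point, one of the two terms of `dη` disappears and
    -- the other is the derivative sought.
    have h4 : (fun v ↦ S.η (u v) (mfderiv 𝓘(ℝ, V₁ × V₂) I u v ((0 : V₁), Z))) =ᶠ[𝓝 (p, q)]
        fun _ ↦ 0 := by
      filter_upwards [(h.isOpen_fst.prod h.isOpen_snd).mem_nhds ⟨hp, hq⟩] with v hv
      obtain ⟨X, hX⟩ := h.exists_ξ v.1 hv.1 v.2 hv.2
      rw [h.η_eq hv.1 hv.2 hX]
      simp
    rw [h4.fderiv_eq] at h3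
    simp at h3
    simpa using h3.symm
  exact h.isOpen_snd.is_const_of_fderiv_eq_zero h.isPreconnected_snd
    (fun q hq ↦ (hd q hq).differentiableAt.differentiableWithinAt) (fun q hq ↦ (hd q hq).fderiv)
    hq hq'

/-- The two vectors represent, through the positive form `G₁` at `p`, the same 1-form `η` on the
first factor. Testing on their difference shows that its `G₁`-square is zero. -/
lemma smul_eq (h : IsLocalWarped S u O₁ O₂ F₁ F₂ G₁ G₂) (hS : IsTransSasakian S α β)
    {p : V₁} (hp : p ∈ O₁) {q q' : V₂} (hq : q ∈ O₂) (hq' : q' ∈ O₂) {X X' : V₁}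
    (hX : mfderiv 𝓘(ℝ, V₁ × V₂) I u (p, q) (X, (0 : V₂)) = S.ξ (u (p, q)))
    (hX' : mfderiv 𝓘(ℝ, V₁ × V₂) I u (p, q') (X', (0 : V₂)) = S.ξ (u (p, q'))) :
    F₂ q ^ 2 • X = F₂ q' ^ 2 • X' := by
  have h1 := h.η_mfderiv_eq hS hp hq hq' (F₂ q ^ 2 • X - F₂ q' ^ 2 • X')
  rw [h.η_eq hp hq hX, h.η_eq hp hq' hX'] at h1
  by_contra hne
  have h2 := h.G₁_pos p hp _ (sub_ne_zero.2 hne)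
  have h3 : ∀ W, G₁ p (F₂ q ^ 2 • X - F₂ q' ^ 2 • X') W =
      F₂ q ^ 2 * G₁ p X W - F₂ q' ^ 2 * G₁ p X' W := by simp
  rw [h3] at h2
  exact h2.ne' (sub_eq_zero.2 h1)

/-- The warping function of the factor containing `ξ` is constant. -/
lemma warping_eq (h : IsLocalWarped S u O₁ O₂ F₁ F₂ G₁ G₂) (hS : IsTransSasakian S α β)
    {p : V₁} (hp : p ∈ O₁) {q q' : V₂} (hq : q ∈ O₂) (hq' : q' ∈ O₂) : F₂ q = F₂ q' := by
  obtain ⟨X, hX⟩ := h.exists_ξ p hp q hq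
  obtain ⟨X', hX'⟩ := h.exists_ξ p hp q' hq'
  have h1 := h.smul_eq hS hp hq hq' hX hX'
  have h2 := h.η_eq hp hq hX (X, 0)
  have h3 := h.η_eq hp hq' hX' (X', 0)
  rw [hX, S.η_ξ] at h2
  rw [hX', S.η_ξ] at h3
  -- Both sides are the `G₁`-square of the same vector; the inner factors are `η(ξ) = 1`, which
  -- leaves the squares of the warping function.
  have h4 : F₂ q ^ 2 * (F₂ q ^ 2 * G₁ p X X) = F₂ q' ^ 2 * (F₂ q' ^ 2 * G₁ p X' X') := by
    have := congrArg (fun Y ↦ G₁ p Y Y) h1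
    simpa using this
  simp only at h2 h3
  rw [← h2, ← h3, mul_one, mul_one] at h4
  exact (sq_eq_sq₀ (h.F₂_pos q hq).le (h.F₂_pos q' hq').le).1 h4

/-- The function `β` does not depend on the variable of the factor orthogonal to `ξ`. -/
lemma β_eq (h : IsLocalWarped S u O₁ O₂ F₁ F₂ G₁ G₂) (hS : IsTransSasakian S α β)
    {p : V₁} (hp : p ∈ O₁) {q q' : V₂} (hq : q ∈ O₂) (hq' : q' ∈ O₂) :
    β (u (p, q)) = β (u (p, q')) := by
  -- The proof needs a nonzero vector in the second factor; if there is none, `q` and `q'` coincide.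
  rcases subsingleton_or_nontrivial V₂ with hV | hV
  · rw [Subsingleton.elim q q']
  obtain ⟨Z, hZ⟩ := exists_ne (0 : V₂)
  obtain ⟨X, hX⟩ := h.exists_ξ p hp q hq
  -- Once the warping function is constant, one vector `X` represents `ξ` at every `(p, q')`; this
  -- provides the hypothesis along the line in the direction `Z`.
  have hX' : ∀ q' ∈ O₂, mfderiv 𝓘(ℝ, V₁ × V₂) I u (p, q') (X, (0 : V₂)) = S.ξ (u (p, q')) := by
    intro q' hq'
    obtain ⟨X', hX'⟩ := h.exists_ξ p hp q' hq'
    have h1 := h.smul_eq hS hp hq hq' hX hX'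
    rw [h.warping_eq hS hp hq hq'] at h1
    rw [smul_right_injective V₁ (pow_ne_zero 2 (h.F₂_pos q' hq').ne') h1, hX']
  -- Derivative of `|Z|² = F₁² G₂(Z, Z)` along `ξ`, divided by `G₂(Z, Z)`. The left side does not
  -- involve `q`, so neither does `β`.
  have key : ∀ q ∈ O₂, fderiv ℝ (fun p ↦ F₁ p ^ 2) p X = 2 * β (u (p, q)) * F₁ p ^ 2 := by
    intro q hq
    have hline : Filter.Tendsto (fun t : ℝ ↦ q + t • Z) (𝓝 0) (𝓝 q) :=
      Continuous.tendsto' (by fun_prop) _ _ (by simp)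
    have h1 := hS.fderiv_inner_mfderiv_self (h.contMDiffAt p hp q hq) ((0 : V₁), Z) (X, (0 : V₂)) (by
      filter_upwards [hline.eventually (h.isOpen_snd.mem_nhds hq)] with t ht
      have h2 : (p, q) + t • ((0 : V₁), Z) = (p, q + t • Z) := by ext <;> simp
      rw [h2, hX' _ ht])
    rw [h.η_eq hp hq (hX' q hq), h.metric_eq p hp q hq] at h1
    have hG := (h.G₂_pos q hq Z hZ).ne'
    have h4 : (fun v ↦ S.g.inner (u v) (mfderiv 𝓘(ℝ, V₁ × V₂) I u v ((0 : V₁), Z))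
        (mfderiv 𝓘(ℝ, V₁ × V₂) I u v ((0 : V₁), Z))) ∘ (fun p ↦ (p, q)) =ᶠ[𝓝 p]
        fun p ↦ G₂ q Z Z * F₁ p ^ 2 := by
      filter_upwards [h.isOpen_fst.mem_nhds hp] with p hp
      rw [Function.comp, h.metric_eq p hp q hq]
      simp [mul_comm]
    have h5 := HasFDerivAt.comp (f := fun p ↦ (p, q)) p (differentiableAt_inner_mfderiv_self S.g
      (h.contMDiffAt p hp q hq) ((0 : V₁), Z)).hasFDerivAt (hasFDerivAt_prodMk_left p q)
    have h6 := (h5.congr_of_eventuallyEq h4.symm).const_mul (G₂ q Z Z)⁻¹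
    simp only [inv_mul_cancel_left₀ hG] at h6
    rw [h6.fderiv, smul_apply, ContinuousLinearMap.comp_apply, ContinuousLinearMap.inl_apply,
      h1]
    simp only [map_zero, mul_zero, zero_add, smul_eq_mul]
    field_simp
    ring
  have h1 := key q hq
  rw [key q' hq'] at h1
  have := (h.F₁_pos p hp).ne'
  field_simp at h1
  linarith

end IsLocalWarped

end LocalProduct

/-! ### Product charts composed with a map on `B × F` -/

section ChartProduct

variable {E : Type*} [NormedAddCommGroup E] [NormedSpace ℝ E]
  {H : Type*} [TopologicalSpace H] {E' : Type*} [NormedAddCommGroup E'] [NormedSpace ℝ E']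
  {H' : Type*} [TopologicalSpace H'] {E'' : Type*} [NormedAddCommGroup E''] [NormedSpace ℝ E'']
  {H'' : Type*} [TopologicalSpace H'']
  {IB : ModelWithCorners ℝ E H} {B : Type*} [TopologicalSpace B] [ChartedSpace H B]
  [IsManifold IB ∞ B] {IF : ModelWithCorners ℝ E' H'} {F : Type*} [TopologicalSpace F]
  [ChartedSpace H' F] [IsManifold IF ∞ F] {I : ModelWithCorners ℝ E'' H''} {M : Type*}
  [TopologicalSpace M] [ChartedSpace H'' M]

/-- The vector tangent to `B × F` with components `X` and `Z`. -/
def tangentPair (IB : ModelWithCorners ℝ E H) (IF : ModelWithCorners ℝ E' H') {x : B} {y : F}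
    (X : TangentSpace IB x) (Z : TangentSpace IF y) : TangentSpace (IB.prod IF) (x, y) :=
  (X, Z)

/-- The derivative of the inverse of the chart at `x₀`. -/
def chartSymmDeriv (IB : ModelWithCorners ℝ E H) (x₀ : B) (p : E) :
    E →L[ℝ] TangentSpace IB ((extChartAt IB x₀).symm p) :=
  mfderiv 𝓘(ℝ, E) IB (extChartAt IB x₀).symm p

/-- A map from a product of charts of `B` and `F`, obtained from a map on `B × F`. -/
def chartProduct (IB : ModelWithCorners ℝ E H) (IF : ModelWithCorners ℝ E' H') (j : B × F → M)
    (x₀ : B) (y₀ : F) (v : E × E') : M :=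
  j ((extChartAt IB x₀).symm v.1, (extChartAt IF y₀).symm v.2)

lemma contMDiffAt_extChartAt_symm [IB.Boundaryless] {x₀ : B} {p : E}
    (hp : p ∈ (extChartAt IB x₀).target) :
    ContMDiffAt 𝓘(ℝ, E) IB ∞ (extChartAt IB x₀).symm p :=
  (contMDiffOn_extChartAt_symm x₀).contMDiffAt ((isOpen_extChartAt_target x₀).mem_nhds hp)

lemma isInvertible_chartSymmDeriv [IB.Boundaryless] {x₀ : B} {p : E}
    (hp : p ∈ (extChartAt IB x₀).target) :
    (chartSymmDeriv IB x₀ p).IsInvertible := by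
  have : IsManifold IB 1 B := .of_le (n := ∞) (by exact_mod_cast le_top)
  have := isInvertible_mfderivWithin_extChartAt_symm hp
  rw [IB.range_eq_univ, mfderivWithin_univ] at this
  exact this

variable [IB.Boundaryless] [IF.Boundaryless] {j : B × F → M} {x₀ : B} {y₀ : F} {p : E} {q : E'}

lemma contMDiffAt_prod_extChartAt_symm (hp : p ∈ (extChartAt IB x₀).target)
    (hq : q ∈ (extChartAt IF y₀).target) :
    ContMDiffAt 𝓘(ℝ, E × E') (IB.prod IF) ∞
      (fun v : E × E' ↦ ((extChartAt IB x₀).symm v.1, (extChartAt IF y₀).symm v.2)) (p, q) :=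
  ((contMDiffAt_extChartAt_symm hp).comp (p, q) contDiff_fst.contMDiff.contMDiffAt).prodMk
    ((contMDiffAt_extChartAt_symm hq).comp (p, q) contDiff_snd.contMDiff.contMDiffAt)

lemma contMDiffAt_chartProduct (hj : ContMDiff (IB.prod IF) I ∞ j)
    (hp : p ∈ (extChartAt IB x₀).target) (hq : q ∈ (extChartAt IF y₀).target) :
    ContMDiffAt 𝓘(ℝ, E × E') I ∞ (chartProduct IB IF j x₀ y₀) (p, q) :=
  hj.contMDiffAt.comp (p, q) (contMDiffAt_prod_extChartAt_symm hp hq)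

lemma mfderiv_chartProduct (hj : ContMDiff (IB.prod IF) I ∞ j)
    (hp : p ∈ (extChartAt IB x₀).target) (hq : q ∈ (extChartAt IF y₀).target) (v : E × E') :
    mfderiv 𝓘(ℝ, E × E') I (chartProduct IB IF j x₀ y₀) (p, q) v =
      mfderiv (IB.prod IF) I j ((extChartAt IB x₀).symm p, (extChartAt IF y₀).symm q)
        (tangentPair IB IF (chartSymmDeriv IB x₀ p v.1) (chartSymmDeriv IF y₀ q v.2)) := by
  have h1 : MDifferentiableAt 𝓘(ℝ, E) IB (extChartAt IB x₀).symm p :=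
    (contMDiffAt_extChartAt_symm hp).mdifferentiableAt (by simp)
  have h2 : MDifferentiableAt 𝓘(ℝ, E') IF (extChartAt IF y₀).symm q :=
    (contMDiffAt_extChartAt_symm hq).mdifferentiableAt (by simp)
  have hf : MDifferentiableAt 𝓘(ℝ, E × E') 𝓘(ℝ, E) (Prod.fst : E × E' → E) (p, q) :=
    differentiableAt_fst.mdifferentiableAt
  have hs : MDifferentiableAt 𝓘(ℝ, E × E') 𝓘(ℝ, E') (Prod.snd : E × E' → E') (p, q) :=
    differentiableAt_snd.mdifferentiableAt
  have h3 := mfderiv_comp_apply (I := 𝓘(ℝ, E × E')) (p, q) (g := j)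
    (f := fun v : E × E' ↦ ((extChartAt IB x₀).symm v.1, (extChartAt IF y₀).symm v.2))
    (hj.mdifferentiableAt (by simp))
    ((contMDiffAt_prod_extChartAt_symm hp hq).mdifferentiableAt (by simp)) v
  refine h3.trans (congrArg _ ?_)
  have h4 := mfderiv_prodMk (I := 𝓘(ℝ, E × E')) (h1.comp (p, q) hf) (h2.comp (p, q) hs)
  refine (congrArg (· v) h4).trans ?_
  refine Prod.ext ?_ ?_
  · refine (mfderiv_comp_apply (p, q) h1 hf v).trans ?_
    rw [mfderiv_eq_fderiv, fderiv_fst]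
    rfl
  · refine (mfderiv_comp_apply (p, q) h2 hs v).trans ?_
    rw [mfderiv_eq_fderiv, fderiv_snd]
    rfl

lemma mfderiv_chartProduct_left (hj : ContMDiff (IB.prod IF) I ∞ j)
    (hp : p ∈ (extChartAt IB x₀).target) (hq : q ∈ (extChartAt IF y₀).target) (X : E) :
    mfderiv 𝓘(ℝ, E × E') I (chartProduct IB IF j x₀ y₀) (p, q) (X, (0 : E')) =
      mfderiv (IB.prod IF) I j ((extChartAt IB x₀).symm p, (extChartAt IF y₀).symm q)
        (tangentPair IB IF (chartSymmDeriv IB x₀ p X) 0) := by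
  rw [mfderiv_chartProduct hj hp hq, map_zero]

lemma mfderiv_chartProduct_right (hj : ContMDiff (IB.prod IF) I ∞ j)
    (hp : p ∈ (extChartAt IB x₀).target) (hq : q ∈ (extChartAt IF y₀).target) (Z : E') :
    mfderiv 𝓘(ℝ, E × E') I (chartProduct IB IF j x₀ y₀) (p, q) ((0 : E), Z) =
      mfderiv (IB.prod IF) I j ((extChartAt IB x₀).symm p, (extChartAt IF y₀).symm q)
        (tangentPair IB IF 0 (chartSymmDeriv IF y₀ q Z)) := by
  rw [mfderiv_chartProduct hj hp hq, map_zero]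

end ChartProduct

/-! ### From local to global on a product of manifolds -/

section WarpedMaps

variable {E : Type*} [NormedAddCommGroup E] [NormedSpace ℝ E]
  {H : Type*} [TopologicalSpace H] {E' : Type*} [NormedAddCommGroup E'] [NormedSpace ℝ E']
  {H' : Type*} [TopologicalSpace H'] {E'' : Type*} [NormedAddCommGroup E''] [NormedSpace ℝ E'']
  {H'' : Type*} [TopologicalSpace H'']
  {IB : ModelWithCorners ℝ E H} {B : Type*} [TopologicalSpace B] [ChartedSpace H B]
  [IsManifold IB ∞ B] {IF : ModelWithCorners ℝ E' H'} {F : Type*} [TopologicalSpace F]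
  [ChartedSpace H' F] [IsManifold IF ∞ F] {I : ModelWithCorners ℝ E'' H''} {M : Type*}
  [TopologicalSpace M] [ChartedSpace H'' M] [IsManifold I ∞ M]

/-- The metric in the chart at `x₀`, as a bilinear form at each point. -/
def chartMetric (gB : RiemMetric IB B) (x₀ : B) (p : E) : E →ₗ[ℝ] E →ₗ[ℝ] ℝ :=
  LinearMap.mk₂ ℝ (fun X Y : E ↦ gB.inner ((extChartAt IB x₀).symm p) (chartSymmDeriv IB x₀ p X)
    (chartSymmDeriv IB x₀ p Y)) (fun _ _ _ ↦ by rw [map_add, map_add, add_apply])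
    (fun _ _ _ ↦ by rw [map_smul, map_smul, smul_apply]) (fun _ _ _ ↦ by rw [map_add, map_add])
    (fun _ _ _ ↦ by rw [map_smul, map_smul])

/-- A map `j` from `B × F` to an almost contact metric manifold, which pulls the metric back to the
doubly warped product metric `f² g_B ⊕ b² g_F`, and such that the images of the two factors under
`φ` and the identity are orthogonal. -/
structure IsWarpedMap (S : AlmostContactMetric I M) (j : B × F → M) (f : F → ℝ)
    (gB : RiemMetric IB B) (b : B → ℝ) (gF : RiemMetric IF F) : Prop where
  contMDiff : ContMDiff (IB.prod IF) I ∞ j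
  f_pos : ∀ y, 0 < f y
  b_pos : ∀ x, 0 < b x
  metric_eq : ∀ (x : B) (y : F) (X X' : TangentSpace IB x) (Z Z' : TangentSpace IF y),
    S.g.inner (j (x, y)) (mfderiv (IB.prod IF) I j (x, y) (tangentPair IB IF X Z))
      (mfderiv (IB.prod IF) I j (x, y) (tangentPair IB IF X' Z')) =
    f y ^ 2 * gB.inner x X X' + b x ^ 2 * gF.inner y Z Z'
  inner_φ : ∀ (x : B) (y : F) (X : TangentSpace IB x) (Z : TangentSpace IF y),
    S.g.inner (j (x, y))
      (S.φ (j (x, y)) (mfderiv (IB.prod IF) I j (x, y) (tangentPair IB IF 0 Z)))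
      (mfderiv (IB.prod IF) I j (x, y) (tangentPair IB IF X 0)) = 0

omit [IsManifold IB ∞ B] [IsManifold IF ∞ F] in
lemma mfderiv_swap (x : B) (y : F) (X : TangentSpace IB x) (Z : TangentSpace IF y) :
    mfderiv (IF.prod IB) (IB.prod IF) (Prod.swap : F × B → B × F) (y, x) (tangentPair IF IB Z X) =
      tangentPair IB IF X Z := by
  have h := mfderiv_prodMk (x := (y, x)) (mdifferentiableAt_snd (I := IF) (I' := IB))
    (mdifferentiableAt_fst (I := IF) (I' := IB))
  refine (congrArg (· (tangentPair IF IB Z X)) h).trans ?_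
  rw [mfderiv_snd, mfderiv_fst]
  rfl

namespace IsWarpedMap

variable {S : AlmostContactMetric I M} {j : B × F → M} {f : F → ℝ} {gB : RiemMetric IB B}
  {b : B → ℝ} {gF : RiemMetric IF F} {α β : M → ℝ}

lemma mfderiv_comp_swap (h : IsWarpedMap S j f gB b gF) (x : B) (y : F) (X : TangentSpace IB x)
    (Z : TangentSpace IF y) :
    mfderiv (IF.prod IB) I (j ∘ Prod.swap) (y, x) (tangentPair IF IB Z X) =
      mfderiv (IB.prod IF) I j (x, y) (tangentPair IB IF X Z) := by
  have hs : MDifferentiableAt (IF.prod IB) (IB.prod IF) (Prod.swap : F × B → B × F) (y, x) :=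
    mdifferentiableAt_snd.prodMk mdifferentiableAt_fst
  have h1 := mfderiv_comp_apply (y, x) (h.contMDiff.mdifferentiableAt (by simp)) hs
    (tangentPair IF IB Z X)
  rw [mfderiv_swap] at h1
  exact h1

/-- The orthogonality condition is symmetric in the factors because `φ` is skew. Since invariance of
the first factor is not part of the structure, results for `ξ` tangent to the first factor transfer
to the second. -/
lemma swap (h : IsWarpedMap S j f gB b gF) : IsWarpedMap S (j ∘ Prod.swap) b gF f gB where
  contMDiff := h.contMDiff.comp (contMDiff_snd.prodMk contMDiff_fst)
  f_pos := h.b_pos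
  b_pos := h.f_pos
  metric_eq y x Z Z' X X' := by
    rw [h.mfderiv_comp_swap, h.mfderiv_comp_swap]
    exact (h.metric_eq x y X X' Z Z').trans (add_comm _ _)
  inner_φ y x Z X := by
    rw [h.mfderiv_comp_swap, h.mfderiv_comp_swap, S.g_φ_left]
    exact neg_eq_zero.2 (h.inner_φ x y X Z)

variable [IB.Boundaryless] [IF.Boundaryless]

/-- The set `O` is left free because a chart target need not be connected, whereas the local
argument integrates along a connected domain of the second factor. -/
lemma isLocalWarped (h : IsWarpedMap S j f gB b gF)
    (hξ : ∀ x y, ∃ X : TangentSpace IB x,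
      mfderiv (IB.prod IF) I j (x, y) (tangentPair IB IF X 0) = S.ξ (j (x, y)))
    (x₀ : B) (y₀ : F) {O : Set E'} (hO : IsOpen O) (hO' : IsPreconnected O)
    (hOt : O ⊆ (extChartAt IF y₀).target) :
    IsLocalWarped S (chartProduct IB IF j x₀ y₀) (extChartAt IB x₀).target O
      (b ∘ (extChartAt IB x₀).symm) (f ∘ (extChartAt IF y₀).symm)
      (fun p ↦ chartMetric gB x₀ p) (fun q ↦ chartMetric gF y₀ q) where
  isOpen_fst := isOpen_extChartAt_target x₀
  isOpen_snd := hO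
  isPreconnected_snd := hO'
  contMDiffAt p hp q hq := contMDiffAt_chartProduct h.contMDiff hp (hOt hq)
  F₁_pos p _ := h.b_pos _
  F₂_pos q _ := h.f_pos _
  G₁_pos p hp X hX := gB.pos _ _ fun h0 ↦ hX
    ((isInvertible_chartSymmDeriv hp).injective (h0.trans (map_zero _).symm))
  G₂_pos q hq Z hZ := gF.pos _ _ fun h0 ↦ hZ
    ((isInvertible_chartSymmDeriv (hOt hq)).injective (h0.trans (map_zero _).symm))
  metric_eq p hp q hq X Y := by
    rw [mfderiv_chartProduct h.contMDiff hp (hOt hq), mfderiv_chartProduct h.contMDiff hp (hOt hq)]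
    exact h.metric_eq _ _ _ _ _ _
  inner_φ p hp q hq X Z := by
    rw [mfderiv_chartProduct_left h.contMDiff hp (hOt hq),
      mfderiv_chartProduct_right h.contMDiff hp (hOt hq)]
    exact h.inner_φ _ _ _ _
  exists_ξ p hp q hq := by
    obtain ⟨X, hX⟩ := hξ ((extChartAt IB x₀).symm p) ((extChartAt IF y₀).symm q)
    obtain ⟨X', rfl⟩ := (isInvertible_chartSymmDeriv hp).surjective X
    refine ⟨X', ?_⟩
    rw [mfderiv_chartProduct_left h.contMDiff hp (hOt hq)]
    exact hX

variable [FiniteDimensional ℝ E''] [CompleteSpace E''] [I.Boundaryless]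

lemma eventually_eq (h : IsWarpedMap S j f gB b gF) (hS : IsTransSasakian S α β)
    (hξ : ∀ x y, ∃ X : TangentSpace IB x,
      mfderiv (IB.prod IF) I j (x, y) (tangentPair IB IF X 0) = S.ξ (j (x, y)))
    (x₀ : B) (y₀ : F) : ∀ᶠ y in 𝓝 y₀, f y = f y₀ ∧ β (j (x₀, y)) = β (j (x₀, y₀)) := by
  -- A ball inside the chart target is convex, hence a valid connected domain.
  obtain ⟨r, hr, hball⟩ := Metric.isOpen_iff.1 (isOpen_extChartAt_target (I := IF) y₀) _
    (mem_extChartAt_target y₀)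
  have hl := h.isLocalWarped hξ x₀ y₀ Metric.isOpen_ball
    (convex_ball (extChartAt IF y₀ y₀) r).isPreconnected hball
  have hp := mem_extChartAt_target (I := IB) x₀
  have h0 := Metric.mem_ball_self (x := extChartAt IF y₀ y₀) hr
  filter_upwards [(continuousAt_extChartAt (I := IF) y₀).eventually (Metric.ball_mem_nhds _ hr),
    (isOpen_extChartAt_source (I := IF) y₀).mem_nhds (mem_extChartAt_source y₀)] with y hy hys
  have h1 := hl.warping_eq hS hp hy h0
  have h2 := hl.β_eq hS hp hy h0
  simp only [Function.comp, chartProduct, extChartAt_to_inv, (extChartAt IF y₀).left_inv hys]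
    at h1 h2
  exact ⟨h1, h2⟩

lemma f_eq [PreconnectedSpace F] [Nonempty B] (h : IsWarpedMap S j f gB b gF)
    (hS : IsTransSasakian S α β)
    (hξ : ∀ x y, ∃ X : TangentSpace IB x,
      mfderiv (IB.prod IF) I j (x, y) (tangentPair IB IF X 0) = S.ξ (j (x, y))) (y y' : F) :
    f y = f y' :=
  ((IsLocallyConstant.iff_eventually_eq f).2 fun y ↦
    (h.eventually_eq hS hξ (Classical.arbitrary B) y).mono fun _ h ↦ h.1).apply_eq_of_preconnectedSpace
    y y'

lemma β_eq [PreconnectedSpace F] (h : IsWarpedMap S j f gB b gF)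
    (hS : IsTransSasakian S α β)
    (hξ : ∀ x y, ∃ X : TangentSpace IB x,
      mfderiv (IB.prod IF) I j (x, y) (tangentPair IB IF X 0) = S.ξ (j (x, y))) (x : B) (y y' : F) :
    β (j (x, y)) = β (j (x, y')) :=
  ((IsLocallyConstant.iff_eventually_eq fun y ↦ β (j (x, y))).2 fun y ↦
    (h.eventually_eq hS hξ x y).mono fun _ h ↦ h.2).apply_eq_of_preconnectedSpace y y'

omit [FiniteDimensional ℝ E''] [CompleteSpace E''] in
/-- The set where `η` does not vanish on the first factor is open. -/
lemma isOpen_η_ne_zero (h : IsWarpedMap S j f gB b gF) :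
    IsOpen {z : B × F | ∃ X : TangentSpace IB z.1,
      S.η (j z) (mfderiv (IB.prod IF) I j z (tangentPair IB IF X 0)) ≠ 0} := by
  rw [isOpen_iff_mem_nhds]
  set P : Set (B × F) := {z : B × F | ∃ X : TangentSpace IB z.1,
      S.η (j z) (mfderiv (IB.prod IF) I j z (tangentPair IB IF X 0)) ≠ 0} with hP
  rintro ⟨x₀, y₀⟩ h0
  have hp := mem_extChartAt_target (I := IB) x₀
  have hq := mem_extChartAt_target (I := IF) y₀
  have h1 : ((extChartAt IB x₀).symm (extChartAt IB x₀ x₀),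
      (extChartAt IF y₀).symm (extChartAt IF y₀ y₀)) ∈ P := by
    rwa [extChartAt_to_inv, extChartAt_to_inv]
  obtain ⟨X, hX⟩ := h1
  obtain ⟨X', rfl⟩ := (isInvertible_chartSymmDeriv hp).surjective X
  rw [← mfderiv_chartProduct_left h.contMDiff hp hq] at hX
  -- The vector is extended with constant coordinates `X'`; then `η` on it is continuous and stays
  -- nonzero nearby.
  have hc := (S.differentiableAt_η_mfderiv (contMDiffAt_chartProduct h.contMDiff hp hq)
    (X', (0 : E'))).continuousAt
  have he := hc.eventually_ne hX
  have hm : ContinuousAt (fun z : B × F ↦ (extChartAt IB x₀ z.1, extChartAt IF y₀ z.2)) (x₀, y₀) :=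
    (ContinuousAt.comp (f := Prod.fst) (x := (x₀, y₀)) (continuousAt_extChartAt (I := IB) x₀)
      continuousAt_fst).prodMk (ContinuousAt.comp (f := Prod.snd) (x := (x₀, y₀))
      (continuousAt_extChartAt (I := IF) y₀) continuousAt_snd)
  filter_upwards [hm.eventually he, ((isOpen_extChartAt_source (I := IB) x₀).prod
    (isOpen_extChartAt_source (I := IF) y₀)).mem_nhds
      ⟨mem_extChartAt_source x₀, mem_extChartAt_source y₀⟩] with z hz hzs
  rw [mfderiv_chartProduct_left h.contMDiff ((extChartAt IB x₀).map_source hzs.1)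
    ((extChartAt IF y₀).map_source hzs.2)] at hz
  have h2 : ((extChartAt IB x₀).symm (extChartAt IB x₀ z.1),
      (extChartAt IF y₀).symm (extChartAt IF y₀ z.2)) ∈ P := ⟨_, hz⟩
  rwa [(extChartAt IB x₀).left_inv hzs.1, (extChartAt IF y₀).left_inv hzs.2] at h2

end IsWarpedMap

end WarpedMaps

/-! ### The position of `ξ`, and the vanishing of `α` -/

section Dichotomy

variable {E : Type*} [NormedAddCommGroup E] [NormedSpace ℝ E]
  {H : Type*} [TopologicalSpace H] {E' : Type*} [NormedAddCommGroup E'] [NormedSpace ℝ E']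
  {H' : Type*} [TopologicalSpace H'] {E'' : Type*} [NormedAddCommGroup E''] [NormedSpace ℝ E'']
  {H'' : Type*} [TopologicalSpace H'']
  {IB : ModelWithCorners ℝ E H} {B : Type*} [TopologicalSpace B] [ChartedSpace H B]
  [IsManifold IB ∞ B] {IF : ModelWithCorners ℝ E' H'} {F : Type*} [TopologicalSpace F]
  [ChartedSpace H' F] [IsManifold IF ∞ F] {I : ModelWithCorners ℝ E'' H''} {M : Type*}
  [TopologicalSpace M] [ChartedSpace H'' M] [IsManifold I ∞ M]

namespace IsWarpedMap

variable {S : AlmostContactMetric I M} {j : B × F → M} {f : F → ℝ} {gB : RiemMetric IB B}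
  {b : B → ℝ} {gF : RiemMetric IF F} {α β : M → ℝ}

-- By invariance `φ² X + X = η(X) ξ` is tangent to the first factor, and one divides by `η(X)`.
omit [IsManifold IB ∞ B] [IsManifold IF ∞ F] in
lemma exists_ξ_of_η_ne_zero
    (hinv : ∀ (x : B) (y : F) (X : TangentSpace IB x), ∃ X' : TangentSpace IB x,
      mfderiv (IB.prod IF) I j (x, y) (tangentPair IB IF X' 0) =
        S.φ (j (x, y)) (mfderiv (IB.prod IF) I j (x, y) (tangentPair IB IF X 0)))
    {x : B} {y : F} {X : TangentSpace IB x}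
    (hX : S.η (j (x, y)) (mfderiv (IB.prod IF) I j (x, y) (tangentPair IB IF X 0)) ≠ 0) :
    ∃ X' : TangentSpace IB x,
      mfderiv (IB.prod IF) I j (x, y) (tangentPair IB IF X' 0) = S.ξ (j (x, y)) := by
  obtain ⟨X₁, h₁⟩ := hinv x y X
  obtain ⟨X₂, h₂⟩ := hinv x y X₁
  rw [h₁, S.φ_φ] at h₂
  set c := S.η (j (x, y)) (mfderiv (IB.prod IF) I j (x, y) (tangentPair IB IF X 0))
  have h₃ : tangentPair IB IF (c⁻¹ • (X₂ + X)) (0 : TangentSpace IF y) =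
      c⁻¹ • (tangentPair IB IF X₂ (0 : TangentSpace IF y) + tangentPair IB IF X 0) :=
    Prod.ext rfl (by
      change (0 : TangentSpace IF y) = c⁻¹ • ((0 : TangentSpace IF y) + 0)
      rw [add_zero, smul_zero])
  refine ⟨c⁻¹ • (X₂ + X), ?_⟩
  rw [h₃, map_smul, map_add, h₂, neg_add_eq_sub, sub_add_cancel, smul_smul, inv_mul_cancel₀ hX,
    one_smul]

/-- Evaluating `η = g(ξ, ·)` on the first component `X` of `ξ` gives `f² g_B(X, X)`, so that
component is zero. -/
lemma exists_ξ_of_η_eq_zero (h : IsWarpedMap S j f gB b gF) {x : B} {y : F}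
    (hξ : ∃ (X : TangentSpace IB x) (Z : TangentSpace IF y),
      mfderiv (IB.prod IF) I j (x, y) (tangentPair IB IF X Z) = S.ξ (j (x, y)))
    (hX : ∀ X : TangentSpace IB x,
      S.η (j (x, y)) (mfderiv (IB.prod IF) I j (x, y) (tangentPair IB IF X 0)) = 0) :
    ∃ Z : TangentSpace IF y,
      mfderiv (IB.prod IF) I j (x, y) (tangentPair IB IF 0 Z) = S.ξ (j (x, y)) := by
  obtain ⟨X, Z, hXZ⟩ := hξ
  have h₁ := hX X
  rw [S.η_eq, ← hXZ, h.metric_eq, map_zero, mul_zero, add_zero] at h₁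
  have h₂ : X = 0 := by
    by_contra h0
    exact (mul_pos (pow_pos (h.f_pos y) 2) (gB.pos x X h0)).ne' h₁
  subst h₂
  exact ⟨Z, hXZ⟩

lemma η_right_eq_zero (h : IsWarpedMap S j f gB b gF) {x : B} {y : F}
    (hξ : ∃ X : TangentSpace IB x,
      mfderiv (IB.prod IF) I j (x, y) (tangentPair IB IF X 0) = S.ξ (j (x, y)))
    (Z : TangentSpace IF y) :
    S.η (j (x, y)) (mfderiv (IB.prod IF) I j (x, y) (tangentPair IB IF 0 Z)) = 0 := by
  obtain ⟨X, hX⟩ := hξ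
  rw [S.η_eq, ← hX, h.metric_eq, map_zero, map_zero, zero_apply, mul_zero, mul_zero, add_zero]

lemma η_left_eq_zero (h : IsWarpedMap S j f gB b gF) {x : B} {y : F}
    (hξ : ∃ Z : TangentSpace IF y,
      mfderiv (IB.prod IF) I j (x, y) (tangentPair IB IF 0 Z) = S.ξ (j (x, y)))
    (X : TangentSpace IB x) :
    S.η (j (x, y)) (mfderiv (IB.prod IF) I j (x, y) (tangentPair IB IF X 0)) = 0 := by
  obtain ⟨Z, hZ⟩ := hξ
  rw [S.η_eq, ← hZ, h.metric_eq, map_zero, map_zero, zero_apply, mul_zero, mul_zero, add_zero]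

lemma inner_φ_φ_left (h : IsWarpedMap S j f gB b gF) {x : B} {y : F}
    (hξ : ∃ Z : TangentSpace IF y,
      mfderiv (IB.prod IF) I j (x, y) (tangentPair IB IF 0 Z) = S.ξ (j (x, y)))
    (X : TangentSpace IB x) :
    S.g.inner (j (x, y))
      (S.φ (j (x, y)) (mfderiv (IB.prod IF) I j (x, y) (tangentPair IB IF X 0)))
      (S.φ (j (x, y)) (mfderiv (IB.prod IF) I j (x, y) (tangentPair IB IF X 0))) =
    f y ^ 2 * gB.inner x X X := by
  rw [S.g_φ_φ, h.η_left_eq_zero hξ, h.metric_eq, map_zero, mul_zero, mul_zero, add_zero, sub_zero]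

variable [IB.Boundaryless] [IF.Boundaryless] [I.Boundaryless]

/-- If the first factor is `φ`-invariant and `ξ` is tangent to the product, then `ξ` is everywhere
tangent to the first factor or everywhere tangent to the second one. -/
lemma ξ_left_or_right [ConnectedSpace B] [ConnectedSpace F] (h : IsWarpedMap S j f gB b gF)
    (hinv : ∀ (x : B) (y : F) (X : TangentSpace IB x), ∃ X' : TangentSpace IB x,
      mfderiv (IB.prod IF) I j (x, y) (tangentPair IB IF X' 0) =
        S.φ (j (x, y)) (mfderiv (IB.prod IF) I j (x, y) (tangentPair IB IF X 0)))
    (hξ : ∀ x y, ∃ (X : TangentSpace IB x) (Z : TangentSpace IF y),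
      mfderiv (IB.prod IF) I j (x, y) (tangentPair IB IF X Z) = S.ξ (j (x, y))) :
    (∀ x y, ∃ X : TangentSpace IB x,
      mfderiv (IB.prod IF) I j (x, y) (tangentPair IB IF X 0) = S.ξ (j (x, y))) ∨
    (∀ x y, ∃ Z : TangentSpace IF y,
      mfderiv (IB.prod IF) I j (x, y) (tangentPair IB IF 0 Z) = S.ξ (j (x, y))) := by
  set U : Set (B × F) := {z : B × F | ∃ X : TangentSpace IB z.1,
      S.η (j z) (mfderiv (IB.prod IF) I j z (tangentPair IB IF X 0)) ≠ 0}
  have hU : IsOpen U := h.isOpen_η_ne_zero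
  have hV := h.swap.isOpen_η_ne_zero.preimage (continuous_swap (X := B) (Y := F))
  -- The complement of `U` is the set where `η` is nonzero on the second factor, and openness of
  -- that set is the same lemma after a swap. So `U` is clopen.
  have hUV : Uᶜ = Prod.swap ⁻¹' {z : F × B | ∃ X : TangentSpace IF z.1, S.η ((j ∘ Prod.swap) z)
      (mfderiv (IF.prod IB) I (j ∘ Prod.swap) z (tangentPair IF IB X 0)) ≠ 0} := by
    ext ⟨x, y⟩
    constructor
    · intro hz
      have hz' : ∀ X : TangentSpace IB x,
          S.η (j (x, y)) (mfderiv (IB.prod IF) I j (x, y) (tangentPair IB IF X 0)) = 0 :=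
        fun X ↦ by_contra fun h0 ↦ hz ⟨X, h0⟩
      obtain ⟨Z, hZ⟩ := h.exists_ξ_of_η_eq_zero (hξ x y) hz'
      refine ⟨Z, ?_⟩
      change S.η (j (x, y)) (mfderiv (IF.prod IB) I (j ∘ Prod.swap) (y, x) _) ≠ 0
      rw [h.mfderiv_comp_swap, hZ, S.η_ξ]
      exact one_ne_zero
    · rintro ⟨Z, hZ⟩ ⟨X, hX⟩
      change S.η (j (x, y)) (mfderiv (IF.prod IB) I (j ∘ Prod.swap) (y, x) _) ≠ 0 at hZ
      rw [h.mfderiv_comp_swap] at hZ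
      exact hZ (h.η_right_eq_zero (exists_ξ_of_η_ne_zero hinv hX) Z)
  have hcl : IsClopen U := ⟨⟨hUV ▸ hV⟩, hU⟩
  rcases isClopen_iff.1 hcl with h0 | h0
  · refine .inr fun x y ↦ h.exists_ξ_of_η_eq_zero (hξ x y) fun X ↦ by_contra fun h1 ↦ ?_
    have : (x, y) ∈ U := ⟨X, h1⟩
    rw [h0] at this
    exact this
  · refine .inl fun x y ↦ ?_
    have : (x, y) ∈ U := h0 ▸ Set.mem_univ _
    obtain ⟨X, hX⟩ := this
    exact exists_ξ_of_η_ne_zero hinv hX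

variable [FiniteDimensional ℝ E''] [CompleteSpace E'']

/-- If `ξ` is tangent to the second factor and the first factor is `φ`-invariant and not
zero-dimensional, then `α` vanishes along the product. -/
lemma α_eq_zero [Nontrivial E] (h : IsWarpedMap S j f gB b gF) (hS : IsTransSasakian S α β)
    (hinv : ∀ (x : B) (y : F) (X : TangentSpace IB x), ∃ X' : TangentSpace IB x,
      mfderiv (IB.prod IF) I j (x, y) (tangentPair IB IF X' 0) =
        S.φ (j (x, y)) (mfderiv (IB.prod IF) I j (x, y) (tangentPair IB IF X 0)))
    (hξ : ∀ x y, ∃ Z : TangentSpace IF y,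
      mfderiv (IB.prod IF) I j (x, y) (tangentPair IB IF 0 Z) = S.ξ (j (x, y)))
    (x₀ : B) (y₀ : F) : α (j (x₀, y₀)) = 0 := by
  have hp := mem_extChartAt_target (I := IB) x₀
  have hq := mem_extChartAt_target (I := IF) y₀
  obtain ⟨e, he⟩ := exists_ne (0 : E)
  obtain ⟨X', hX'⟩ := hinv ((extChartAt IB x₀).symm (extChartAt IB x₀ x₀))
    ((extChartAt IF y₀).symm (extChartAt IF y₀ y₀)) (chartSymmDeriv IB x₀ (extChartAt IB x₀ x₀) e)
  -- The vector `e'` represents `φ e` only at the base point. Its constant extension suffices,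
  -- because `η` vanishes on every constant field of the first factor.
  obtain ⟨e', rfl⟩ := (isInvertible_chartSymmDeriv hp).surjective X'
  have hη : ∀ X : E, (fun v ↦ S.η (chartProduct IB IF j x₀ y₀ v)
      (mfderiv 𝓘(ℝ, E × E') I (chartProduct IB IF j x₀ y₀) v (X, (0 : E')))) =ᶠ[𝓝
        (extChartAt IB x₀ x₀, extChartAt IF y₀ y₀)] fun _ ↦ 0 := by
    intro X
    filter_upwards [((isOpen_extChartAt_target (I := IB) x₀).prod
      (isOpen_extChartAt_target (I := IF) y₀)).mem_nhds ⟨hp, hq⟩] with v hv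
    rw [mfderiv_chartProduct_left h.contMDiff hv.1 hv.2]
    exact h.η_left_eq_zero (hξ _ _) _
  have h1 := hS.fderiv_η_sub (contMDiffAt_chartProduct h.contMDiff hp hq) (e, (0 : E'))
    (e', (0 : E'))
  rw [(hη e).fderiv_eq, (hη e').fderiv_eq, mfderiv_chartProduct_left h.contMDiff hp hq,
    mfderiv_chartProduct_left h.contMDiff hp hq, hX'] at h1
  have h2 := h1.trans (congrArg (_ * ·) (h.inner_φ_φ_left (hξ _ _) _))
  have h3 : 0 < gB.inner _ (chartSymmDeriv IB x₀ (extChartAt IB x₀ x₀) e)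
      (chartSymmDeriv IB x₀ (extChartAt IB x₀ x₀) e) := gB.pos _ _ fun h0 ↦ he
    ((isInvertible_chartSymmDeriv hp).injective (h0.trans (map_zero _).symm))
  have h4 := mul_pos (pow_pos (h.f_pos ((extChartAt IF y₀).symm (extChartAt IF y₀ y₀))) 2) h3
  have h5 : α (chartProduct IB IF j x₀ y₀ (extChartAt IB x₀ x₀, extChartAt IF y₀ y₀)) = 0 := by
    simp only [fderiv_fun_const, Pi.zero_apply, zero_apply, sub_zero] at h2
    rcases mul_eq_zero.1 h2.symm with h6 | h6
    · linarith
    · exact absurd h6 h4.ne'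
  simpa only [chartProduct, extChartAt_to_inv] using h5

end IsWarpedMap

end Dichotomy

/-! ### Translation of the contact CR hypotheses into components -/

section DoublyWarped

variable {E : Type*} [NormedAddCommGroup E] [NormedSpace ℝ E]
  {H : Type*} [TopologicalSpace H] {E' : Type*} [NormedAddCommGroup E'] [NormedSpace ℝ E']
  {H' : Type*} [TopologicalSpace H'] {E'' : Type*} [NormedAddCommGroup E''] [NormedSpace ℝ E'']
  {H'' : Type*} [TopologicalSpace H'']
  {IB : ModelWithCorners ℝ E H} {B : Type*} [TopologicalSpace B] [ChartedSpace H B]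
  {IF : ModelWithCorners ℝ E' H'} {F : Type*} [TopologicalSpace F]
  [ChartedSpace H' F] {I : ModelWithCorners ℝ E'' H''} {M : Type*}
  [TopologicalSpace M] [ChartedSpace H'' M] [IsManifold I ∞ M]

lemma mfderiv_fst_tangentPair {x : B} {y : F} (X : TangentSpace IB x) (Z : TangentSpace IF y) :
    mfderiv (IB.prod IF) IB Prod.fst (x, y) (tangentPair IB IF X Z) = X := by
  rw [mfderiv_fst]
  rfl

lemma mfderiv_snd_tangentPair {x : B} {y : F} (X : TangentSpace IB x) (Z : TangentSpace IF y) :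
    mfderiv (IB.prod IF) IF Prod.snd (x, y) (tangentPair IB IF X Z) = Z := by
  rw [mfderiv_snd]
  rfl

lemma exists_tangentPair_eq {x : B} {y : F} (v : TangentSpace (IB.prod IF) (x, y)) :
    ∃ (X : TangentSpace IB x) (Z : TangentSpace IF y), tangentPair IB IF X Z = v :=
  ⟨v.1, v.2, rfl⟩

lemma mem_leafDistribution {x : B} {y : F} {v : TangentSpace (IB.prod IF) (x, y)} :
    v ∈ leafDistribution IB B IF F (x, y) ↔ ∃ X : TangentSpace IB x, tangentPair IB IF X 0 = v := by
  unfold leafDistribution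
  rw [mfderiv_prod_left]
  exact LinearMap.mem_range

variable [IsManifold IB ∞ B] [IsManifold IF ∞ F] {S : AlmostContactMetric I M}
  {g : RiemMetric (IB.prod IF) (B × F)} {f : F → ℝ} {gB : RiemMetric IB B} {b : B → ℝ}
  {gF : RiemMetric IF F} {j : B × F → M} {α β : M → ℝ}

lemma IsDoublyWarped.inner_tangentPair (h : IsDoublyWarped g f gB b gF) {x : B} {y : F}
    (X X' : TangentSpace IB x) (Z Z' : TangentSpace IF y) :
    g.inner (x, y) (tangentPair IB IF X Z) (tangentPair IB IF X' Z') =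
      f y ^ 2 * gB.inner x X X' + b x ^ 2 * gF.inner y Z Z' := by
  exact (h.metric_eq (x, y) _ _).trans (congrArg₂ (· + ·)
    (congrArg (f y ^ 2 * ·) (congrArg₂ (fun X X' ↦ gB.inner x X X')
      (mfderiv_fst_tangentPair X Z) (mfderiv_fst_tangentPair X' Z')))
    (congrArg (b x ^ 2 * ·) (congrArg₂ (fun Z Z' ↦ gF.inner y Z Z')
      (mfderiv_snd_tangentPair X Z) (mfderiv_snd_tangentPair X' Z'))))

/-- The metric is block diagonal, and pairing a vector with its own first component `X` gives `f²
g_B(X, X)`. -/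
lemma IsDoublyWarped.mem_orthDistribution (h : IsDoublyWarped g f gB b gF) {x : B} {y : F}
    {v : TangentSpace (IB.prod IF) (x, y)} :
    v ∈ orthDistribution g (leafDistribution IB B IF F) (x, y) ↔
      ∃ Z : TangentSpace IF y, tangentPair IB IF 0 Z = v := by
  constructor
  · intro hv
    obtain ⟨X, Z, rfl⟩ := exists_tangentPair_eq v
    have h₁ := hv _ (mem_leafDistribution.2 ⟨X, rfl⟩)
    rw [h.inner_tangentPair, map_zero, zero_apply, mul_zero, add_zero] at h₁
    have h₂ : X = 0 := by
      by_contra h0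
      exact (mul_pos (pow_pos (h.f_pos y) 2) (gB.pos x X h0)).ne' h₁
    exact ⟨Z, by rw [h₂]⟩
  · rintro ⟨Z, rfl⟩ u hu
    obtain ⟨X, rfl⟩ := mem_leafDistribution.1 hu
    rw [h.inner_tangentPair, map_zero, map_zero, zero_apply, mul_zero, mul_zero, add_zero]

omit [IsManifold IB ∞ B] [IsManifold IF ∞ F] in
lemma xiIn_leafDistribution_iff :
    XiIn (I := IB.prod IF) S j (leafDistribution IB B IF F) ↔
      ∀ x y, ∃ X : TangentSpace IB x,
        mfderiv (IB.prod IF) I j (x, y) (tangentPair IB IF X 0) = S.ξ (j (x, y)) := by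
  constructor
  · intro h x y
    obtain ⟨v, hv, hv'⟩ := h (x, y)
    obtain ⟨X, rfl⟩ := mem_leafDistribution.1 hv
    exact ⟨X, hv'⟩
  · rintro h ⟨x, y⟩
    obtain ⟨X, hX⟩ := h x y
    exact ⟨_, mem_leafDistribution.2 ⟨X, rfl⟩, hX⟩

lemma IsDoublyWarped.xiIn_orthDistribution_iff
    (h : IsDoublyWarped g f gB b gF) :
    XiIn (I := IB.prod IF) S j (orthDistribution g (leafDistribution IB B IF F)) ↔
      ∀ x y, ∃ Z : TangentSpace IF y,
        mfderiv (IB.prod IF) I j (x, y) (tangentPair IB IF 0 Z) = S.ξ (j (x, y)) := by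
  constructor
  · intro h' x y
    obtain ⟨v, hv, hv'⟩ := h' (x, y)
    obtain ⟨Z, rfl⟩ := h.mem_orthDistribution.1 hv
    exact ⟨Z, hv'⟩
  · rintro h' ⟨x, y⟩
    obtain ⟨Z, hZ⟩ := h' x y
    exact ⟨_, h.mem_orthDistribution.2 ⟨Z, rfl⟩, hZ⟩

/-- If `f` is constant, then the doubly warped product is a warped product over the first
factor. -/
lemma IsDoublyWarped.isWarpedOverFst [FiniteDimensional ℝ E] (h : IsDoublyWarped g f gB b gF)
    {c : ℝ} (hc : 0 < c) (hf : ∀ y, f y = c) : IsWarpedOverFst g (homothetic c hc gB) b gF where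
  contMDiff_f := contMDiff_const
  f_pos _ := one_pos
  contMDiff_b := h.contMDiff_b
  b_pos := h.b_pos
  metric_eq z u v := by
    rw [h.metric_eq, hf, one_pow, one_mul]
    rfl

/-- If `b` is constant, then the doubly warped product is a warped product over the second
factor. -/
lemma IsDoublyWarped.isWarpedOverSnd [FiniteDimensional ℝ E'] (h : IsDoublyWarped g f gB b gF)
    {c : ℝ} (hc : 0 < c) (hb : ∀ x, b x = c) : IsWarpedOverSnd g f gB (homothetic c hc gF) where
  contMDiff_f := h.contMDiff_f
  f_pos := h.f_pos
  contMDiff_b := contMDiff_const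
  b_pos _ := one_pos
  metric_eq z u v := by
    rw [h.metric_eq, hb, one_pow, one_mul]
    rfl

namespace IsDoublyWarpedContactCR

lemma isWarpedMap (h : IsDoublyWarpedContactCR S g j f gB b gF) :
    IsWarpedMap S j f gB b gF where
  contMDiff := h.contactCR.isometricImmersion.contMDiff
  f_pos := h.doublyWarped.f_pos
  b_pos := h.doublyWarped.b_pos
  metric_eq x y X X' Z Z' := by
    rw [h.contactCR.isometricImmersion.isometric, h.doublyWarped.inner_tangentPair]
  inner_φ x y X Z :=
    h.contactCR.antiInvariant _ _ (h.doublyWarped.mem_orthDistribution.2 ⟨Z, rfl⟩) _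

lemma exists_φ_left (h : IsDoublyWarpedContactCR S g j f gB b gF) (x : B) (y : F)
    (X : TangentSpace IB x) : ∃ X' : TangentSpace IB x,
      mfderiv (IB.prod IF) I j (x, y) (tangentPair IB IF X' 0) =
        S.φ (j (x, y)) (mfderiv (IB.prod IF) I j (x, y) (tangentPair IB IF X 0)) := by
  obtain ⟨w, hw, hw'⟩ := h.contactCR.invariant (x, y) _ (mem_leafDistribution.2 ⟨X, rfl⟩)
  obtain ⟨X', rfl⟩ := mem_leafDistribution.1 hw
  exact ⟨X', hw'⟩

lemma exists_ξ (h : IsDoublyWarpedContactCR S g j f gB b gF) (x : B) (y : F) :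
    ∃ (X : TangentSpace IB x) (Z : TangentSpace IF y),
      mfderiv (IB.prod IF) I j (x, y) (tangentPair IB IF X Z) = S.ξ (j (x, y)) := by
  obtain ⟨v, hv⟩ := h.contactCR.ξ_tangent (x, y)
  obtain ⟨X, Z, rfl⟩ := exists_tangentPair_eq v
  exact ⟨X, Z, hv⟩

end IsDoublyWarpedContactCR

end DoublyWarped

end TransSasakian

end

/-! ### The theorem -/

open TransSasakian in
theorem mainTheorem2 {m p q : ℕ}
    {M' : Type*} [TopologicalSpace M'] [T2Space M'] [SecondCountableTopology M']
    [ChartedSpace (EuclideanSpace ℝ (Fin (2 * m + 1))) M'] [IsManifold (𝓡 (2 * m + 1)) ∞ M']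
    {N₁ : Type*} [TopologicalSpace N₁] [T2Space N₁] [SecondCountableTopology N₁]
    [ConnectedSpace N₁] [ChartedSpace (EuclideanSpace ℝ (Fin p)) N₁] [IsManifold (𝓡 p) ∞ N₁]
    {N₂ : Type*} [TopologicalSpace N₂] [T2Space N₂] [SecondCountableTopology N₂]
    [ConnectedSpace N₂] [ChartedSpace (EuclideanSpace ℝ (Fin q)) N₂] [IsManifold (𝓡 q) ∞ N₂]
    (S : AlmostContactMetric (𝓡 (2 * m + 1)) M') (α β : M' → ℝ)
    (hS : IsAlphaSasakian S α ∨ IsBetaKenmotsu S β ∨ IsCosymplectic S)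
    (g₁ : RiemMetric (𝓡 p) N₁) (g₂ : RiemMetric (𝓡 q) N₂) (f₁ : N₁ → ℝ) (f₂ : N₂ → ℝ)
    (g : RiemMetric ((𝓡 p).prod (𝓡 q)) (N₁ × N₂)) (ι : N₁ × N₂ → M')
    (hM : IsDoublyWarpedContactCR S g ι f₂ g₁ f₁ g₂) :
    let D := leafDistribution (𝓡 p) N₁ (𝓡 q) N₂
    ¬ (¬ IsConst f₁ ∧ ¬ IsConst f₂) ∧
    (XiIn (I := (𝓡 p).prod (𝓡 q)) S ι D ∨ XiIn (I := (𝓡 p).prod (𝓡 q)) S ι (orthDistribution g D)) ∧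
    (XiIn (I := (𝓡 p).prod (𝓡 q)) S ι D →
      (∃ (c : ℝ) (hc : 0 < c) (f : N₁ → ℝ), IsWarpedOverFst g (homothetic c hc g₁) f g₂) ∧
      (IsBetaKenmotsu S β →
        ∃ b : N₁ → ℝ, ContMDiff (𝓡 p) 𝓘(ℝ, ℝ) ∞ b ∧ ∀ x y, β (ι (x, y)) = b x)) ∧
    (XiIn (I := (𝓡 p).prod (𝓡 q)) S ι (orthDistribution g D) →
      (IsAlphaSasakian S α →
        (IsAntiInvariant (I := (𝓡 p).prod (𝓡 q)) S ι ∧ ∀ z, D z = ⊥) ∨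
        ((∀ z, α (ι z) = 0) ∧
          ∃ (c : ℝ) (hc : 0 < c) (f : N₂ → ℝ), IsWarpedOverSnd g f g₁ (homothetic c hc g₂))) ∧
      (IsBetaKenmotsu S β ∨ IsCosymplectic S →
        ∃ (c : ℝ) (hc : 0 < c) (f : N₂ → ℝ), IsWarpedOverSnd g f g₁ (homothetic c hc g₂)) ∧
      (IsBetaKenmotsu S β →
        ∃ b : N₂ → ℝ, ContMDiff (𝓡 q) 𝓘(ℝ, ℝ) ∞ b ∧ ∀ x y, β (ι (x, y)) = b y)) := by
  intro D
  have hW := hM.isWarpedMap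
  have hinv := hM.exists_φ_left
  have hfst : XiIn (I := (𝓡 p).prod (𝓡 q)) S ι D ↔ _ := xiIn_leafDistribution_iff
  have hsnd : XiIn (I := (𝓡 p).prod (𝓡 q)) S ι (orthDistribution g D) ↔ _ :=
    hM.doublyWarped.xiIn_orthDistribution_iff
  -- The constancy of the warping functions holds for every type, so the three cases are merged
  -- here.
  obtain ⟨α', β', hS'⟩ : ∃ α' β', IsTransSasakian S α' β' :=
    hS.elim (fun h ↦ ⟨_, _, h⟩) fun h ↦ h.elim (fun h ↦ ⟨_, _, h⟩) fun h ↦ ⟨_, _, h⟩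
  obtain ⟨x₀⟩ := (inferInstance : Nonempty N₁)
  obtain ⟨y₀⟩ := (inferInstance : Nonempty N₂)
  have hsnd' (h : XiIn (I := (𝓡 p).prod (𝓡 q)) S ι (orthDistribution g D)) (y : N₂) (x : N₁) :
      ∃ Z : TangentSpace (𝓡 q) y, mfderiv ((𝓡 q).prod (𝓡 p)) (𝓡 (2 * m + 1)) (ι ∘ Prod.swap) (y, x)
        (tangentPair (𝓡 q) (𝓡 p) Z 0) = S.ξ ((ι ∘ Prod.swap) (y, x)) := by
    obtain ⟨Z, hZ⟩ := hsnd.1 h x y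
    exact ⟨Z, (hW.mfderiv_comp_swap x y 0 Z).trans hZ⟩
  have hor : XiIn (I := (𝓡 p).prod (𝓡 q)) S ι D ∨
      XiIn (I := (𝓡 p).prod (𝓡 q)) S ι (orthDistribution g D) :=
    (hW.ξ_left_or_right hinv hM.exists_ξ).imp hfst.2 hsnd.2
  have hf₂ (h : XiIn (I := (𝓡 p).prod (𝓡 q)) S ι D) (y : N₂) : f₂ y = f₂ y₀ :=
    hW.f_eq hS' (hfst.1 h) y y₀
  have hf₁ (h : XiIn (I := (𝓡 p).prod (𝓡 q)) S ι (orthDistribution g D)) (x : N₁) :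
      f₁ x = f₁ x₀ :=
    hW.swap.f_eq hS' (hsnd' h) x x₀
  have hover (h : XiIn (I := (𝓡 p).prod (𝓡 q)) S ι (orthDistribution g D)) :
      ∃ (c : ℝ) (hc : 0 < c) (f : N₂ → ℝ), IsWarpedOverSnd g f g₁ (homothetic c hc g₂) :=
    ⟨f₁ x₀, hW.b_pos x₀, f₂, hM.doublyWarped.isWarpedOverSnd _ (hf₁ h)⟩
  refine ⟨fun h ↦ hor.elim (fun h' ↦ h.2 ⟨_, hf₂ h'⟩) fun h' ↦ h.1 ⟨_, hf₁ h'⟩, hor,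
    fun h ↦ ⟨⟨f₂ y₀, hW.f_pos y₀, f₁, hM.doublyWarped.isWarpedOverFst _ (hf₂ h)⟩, fun hβ ↦ ?_⟩,
    fun h ↦ ⟨fun hα ↦ ?_, fun _ ↦ hover h, fun hβ ↦ ?_⟩⟩
  · exact ⟨fun x ↦ β (ι (x, y₀)),
      hβ.2.1.comp (hW.contMDiff.comp (contMDiff_id.prodMk contMDiff_const)),
      fun x y ↦ hW.β_eq hβ (hfst.1 h) x y y₀⟩
  -- If `p = 0`, then `D = 0` and every tangent vector lies in its orthogonal complement, which
  -- gives anti-invariance. If `p > 0`, a nonzero vector of `D` forces `α = 0`.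
  · rcases Nat.eq_zero_or_pos p with rfl | hp
    · have hD : ∀ z, D z = ⊥ := by
        rintro ⟨x, y⟩
        refine (Submodule.eq_bot_iff _).2 fun v hv ↦ ?_
        obtain ⟨X, rfl⟩ := mem_leafDistribution.1 hv
        rw [Subsingleton.elim (α := EuclideanSpace ℝ (Fin 0)) X 0]
        rfl
      refine .inl ⟨fun z v w ↦ hM.contactCR.antiInvariant z v (fun u hu ↦ ?_) w, hD⟩
      rw [(Submodule.eq_bot_iff _).1 (hD z) u hu, map_zero, zero_apply]
    · have : Nonempty (Fin p) := ⟨⟨0, hp⟩⟩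
      have : Nontrivial (EuclideanSpace ℝ (Fin p)) := inferInstance
      exact .inr ⟨fun z ↦ hW.α_eq_zero hα hinv (hsnd.1 h) z.1 z.2, hover h⟩
  · exact ⟨fun y ↦ β (ι (x₀, y)),
      hβ.2.1.comp (hW.contMDiff.comp (contMDiff_const.prodMk contMDiff_id)),
      fun x y ↦ hW.swap.β_eq hβ (hsnd' h) y x x₀⟩
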